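/- Fix an arity $k\ge 1$. A *CSP model* $\Upsilon=(\Phi,p)$ of arity $k$ is a set $\Phi$ of functions $\varphi:\{-1,1\}^k\to\{0,1\}$ with a probability distribution $p$ on $\Phi$ with support $\Phi$. The random CSP $C(\Upsilon,n,M)$ over the variables $x_1,\dots,x_n$ consists of $M$ independent constraints, each of them a function $\varphi\in\Phi$ drawn according to $p$ and applied to an independent uniformly random ordered $k$-tuple of distinct variables. In the *planted model* $P(\Upsilon,n,M)$ one takes a uniformly random assignment $\sigma\in\{-1,1\}^n$ and then $F$ drawn from $C(\Upsilon,n,M)$ conditional on $\sigma$ satisfying $F$ (an assignment $\sigma$ for which this condition has probability $0$ is counted as a failure of every event). If $\sigma$ satisfies a constraint $\varphi$, a variable is *essential* for $(\varphi,\sigma)$ if changing its value makes $\varphi$ unsatisfied. The model is *1-essential* if for all $\varphi\in\Phi$ and all $\sigma$ satisfying $\varphi$ at most one variable is essential, and *symmetric* if $\varphi(-x)=\varphi(x)$ for all $\varphi\in\Phi$ and all $x\in\{-1,1\}^k$. The hypergraph $\Gamma(F,\sigma)$ has the variables as vertices, and one hyperedge, formed by the variables of the constraint, for each constraint of $F$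 that has an essential variable; that variable is the essential vertex of the hyperedge. The *\*-core* of $\Gamma(F,\sigma)$ is what remains after repeatedly deleting a vertex that is not essential in any remaining hyperedge, along with all hyperedges containing it (the order does not matter). Let $$\alpha_k=\inf_{x>0}\frac{x}{(1-e^{-x})^{k-1}},$$ and for $\alpha>\alpha_k$ let $x_k(\alpha)$ be the maximum $x\ge 0$ with $\frac{x}{(1-e^{-x})^{k-1}}=\alpha$, and $\rho_k(\alpha)=1-e^{-x_k(\alpha)}$. **Lemma.** Let $\Upsilon$ be a 1-essential, symmetric CSP model of arity $k$ in which at least one $\varphi\in\Phi$ is satisfiable, let $r>0$ and $\alpha$ be real numbers, and let $f(n)=o(n)$ and $g(n)=o(n)$. Draw $(F,\sigma)$ from $P(\Upsilon,n,\lfloor rn\rfloor)$. (a) If $\alpha>\alpha_k$, there is $h(n)=o(n)$ such that for all sufficiently large $n$, with probability at least $1-e^{-g(n)}$: if the number of hyperedges of $\Gamma(F,\sigma)$ is within $f(n)$ of $\alpha n$, then the number of vertices of the \*-core of $\Gamma(F,\sigma)$ is within $h(n)$ of $\rho_k(\alpha)n$. (b) If $\alpha<\alpha_k$, there is $h(n)=o(n)$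 such that for all sufficiently large $n$, with probability at least $1-e^{-g(n)}$: if the number of hyperedges of $\Gamma(F,\sigma)$ is within $f(n)$ of $\alpha n$, then the \*-core of $\Gamma(F,\sigma)$ has at most $h(n)$ vertices. -/

import Mathlib

open Filter Asymptotics

noncomputable section

namespace RandomCSP

/-! ### Boolean constraints and CSP models

The two truth values `1` and `-1` are the two elements of `ℤˣ`. -/

/-- Boolean functions `φ : {-1,1}^k → {0,1}`; `φ s = true` means that `s` satisfies `φ`. -/
abbrev BoolFn (k : ℕ) : Type := (Fin k → ℤˣ) → Bool

/-- A CSP model of arity `k`: a probability distribution `p` on Boolean functions of arity `k`.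
The set `Φ` of the model is the support of `p`. -/
structure CSPModel (k : ℕ) where
  p : BoolFn k → ℝ
  p_nonneg : ∀ φ, 0 ≤ p φ
  p_sum : ∑ φ, p φ = 1

variable {k n M : ℕ}

/-- The set of Boolean functions of the model. -/
def CSPModel.Φ (Υ : CSPModel k) : Set (BoolFn k) := {φ | 0 < Υ.p φ}

/-- The assignment obtained from `σ` by changing the value of the single variable `x`. -/
def flipAt {m : ℕ} (σ : Fin m → ℤˣ) (x : Fin m) : Fin m → ℤˣ :=
  Function.update σ x (-σ x)

/-- `φ(x) = φ(-x)` for every `φ ∈ Φ` and every assignment `x`. -/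
def CSPModel.Symmetric (Υ : CSPModel k) : Prop :=
  ∀ φ ∈ Υ.Φ, ∀ s : Fin k → ℤˣ, φ (-s) = φ s

/-- For every `φ ∈ Φ` and every satisfying assignment `s` of `φ`, at most one variable is essential,
i.e. is such that changing its value results in `φ` being unsatisfied. -/
def CSPModel.OneEssential (Υ : CSPModel k) : Prop :=
  ∀ φ ∈ Υ.Φ, ∀ s : Fin k → ℤˣ, φ s = true →
    ∀ i j : Fin k, φ (flipAt s i) = false → φ (flipAt s j) = false → i = j

/-! ### Constraint satisfaction problems -/

/-- A constraint over the variables `x_1, …, x_n`: a Boolean function applied to an ordered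
`k`-tuple of distinct variables. -/
abbrev Constraint (k n : ℕ) : Type := BoolFn k × (Fin k ↪ Fin n)

/-- The value of a constraint on an assignment to all the variables. -/
def Constraint.eval (c : Constraint k n) (σ : Fin n → ℤˣ) : Bool :=
  c.1 (fun i => σ (c.2 i))

/-- A CSP over `n` variables with `M` constraints. -/
abbrev CSP (k n M : ℕ) : Type := Fin M → Constraint k n

/-- `σ` is a satisfying assignment of `F`. -/
def CSP.Satisfies (F : CSP k n M) (σ : Fin n → ℤˣ) : Prop :=
  ∀ a, Constraint.eval (F a) σ = true

/-- `x` is essential for the constraint `c`, which is satisfied by `σ`: changing the value of `x`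
results in `c` being unsatisfied. -/
def IsEssential (c : Constraint k n) (σ : Fin n → ℤˣ) (x : Fin n) : Prop :=
  Constraint.eval c σ = true ∧ Constraint.eval c (flipAt σ x) = false

/-! ### The random CSP and the planted model -/

/-- The probability of `F` in the model `C(Υ, n, M)`: `M` independent constraints, each of them with
a Boolean function drawn from `p` and, independently, a uniformly random `k`-tuple of distinct
variables. -/
def CSPModel.randomProb (Υ : CSPModel k) (F : CSP k n M) : ℝ :=
  ∏ a, (Υ.p (F a).1 * (1 / (Fintype.card (Fin k ↪ Fin n) : ℝ)))

open scoped Classical in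
/-- The probability of the pair `(F, σ)` in the planted model `P(Υ, n, M)`: the assignment `σ` is
uniformly random, and then `F` is drawn from `C(Υ, n, M)` conditional on `σ` satisfying `F`.
(If that condition has probability `0` the quotient is `0 / 0 = 0`: such a `σ` contributes no mass
to any event, as if every event failed for it.) -/
def CSPModel.plantedProb (Υ : CSPModel k) (F : CSP k n M) (σ : Fin n → ℤˣ) : ℝ :=
  (1 / 2 : ℝ) ^ n *
    (if F.Satisfies σ then
      Υ.randomProb F / ∑ F' : CSP k n M, (if F'.Satisfies σ then Υ.randomProb F' else 0)
    else 0)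

open scoped Classical in
/-- The probability of an event `E` in the planted model `P(Υ, n, M)`. -/
def CSPModel.plantedPr (Υ : CSPModel k) (n M : ℕ)
    (E : CSP k n M → (Fin n → ℤˣ) → Prop) : ℝ :=
  ∑ σ : Fin n → ℤˣ, ∑ F : CSP k n M, (if E F σ then Υ.plantedProb F σ else 0)

/-! ### Hypergraphs with essential vertices, and their *-core -/

/-- A hypergraph whose vertices are taken from `V` and whose hyperedges are labelled by elements of
`ι` (so that repeated hyperedges are possible), together with the relation
`ess e v`: "`v` is essential in the hyperedge `e`". -/
@[ext]
structure EssHypergraph (V ι : Type*) where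
  verts : Finset V
  edges : Finset ι
  inc : ι → Finset V
  ess : ι → V → Prop
  inc_subset : ∀ e ∈ edges, inc e ⊆ verts

namespace EssHypergraph

variable {V ι : Type*} [DecidableEq V]

/-- Delete a vertex along with all the hyperedges that contain it. -/
def deleteVertex (H : EssHypergraph V ι) (v : V) : EssHypergraph V ι where
  verts := H.verts.erase v
  edges := H.edges.filter (fun e => v ∉ H.inc e)
  inc := H.inc
  ess := H.ess
  inc_subset := by
    intro e he w hw
    rw [Finset.mem_filter] at he
    refine Finset.mem_erase.2 ⟨?_, H.inc_subset e he.1 hw⟩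
    rintro rfl
    exact he.2 hw

/-- `v` is a vertex of `H` that is not essential in any hyperedge of `H`. -/
def Removable (H : EssHypergraph V ι) (v : V) : Prop :=
  v ∈ H.verts ∧ ∀ e ∈ H.edges, ¬ H.ess e v

/-- One step of the *-core process: one removable vertex is deleted. -/
def Step (H H' : EssHypergraph V ι) : Prop :=
  ∃ v, H.Removable v ∧ H' = H.deleteVertex v

/-- `K` is an outcome of the *-core process on `H`: it is reached from `H` by repeatedly deleting
removable vertices (in some order), and it has no removable vertex. -/
def IsStarCore (H K : EssHypergraph V ι) : Prop :=
  Relation.ReflTransGen Step H K ∧ ∀ v, ¬ K.Removable v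

theorem exists_isStarCore (H : EssHypergraph V ι) : ∃ K, H.IsStarCore K := by
  generalize hm : H.verts.card = m
  induction m generalizing H with
  | zero =>
    refine ⟨H, .refl, fun v hv => ?_⟩
    rw [Finset.card_eq_zero] at hm
    simpa [hm] using hv.1
  | succ m ih =>
    by_cases h : ∃ v, H.Removable v
    · obtain ⟨v, hv⟩ := h
      obtain ⟨K, hK, hK'⟩ := ih (H.deleteVertex v) (by
        simp [deleteVertex, Finset.card_erase_of_mem hv.1, hm])
      exact ⟨K, .head ⟨v, hv, rfl⟩ hK, hK'⟩
    · exact ⟨H, .refl, fun v hv => h ⟨v, hv⟩⟩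

/-- What the process leaves is determined by the remaining vertices. -/
theorem reach_data {H K : EssHypergraph V ι} (h : Relation.ReflTransGen Step H K) :
    K.verts ⊆ H.verts ∧ K.inc = H.inc ∧ K.ess = H.ess ∧
      ∀ e, e ∈ K.edges ↔ e ∈ H.edges ∧ H.inc e ⊆ K.verts := by
  induction h with
  | refl =>
    exact ⟨subset_rfl, rfl, rfl, fun e => ⟨fun he => ⟨he, H.inc_subset e he⟩, fun he => he.1⟩⟩
  | tail _ hs ih =>
    obtain ⟨v, -, rfl⟩ := hs
    obtain ⟨h1, h2, h3, h4⟩ := ih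
    refine ⟨(Finset.erase_subset _ _).trans h1, h2, h3, fun e => ?_⟩
    simp only [deleteVertex, Finset.mem_filter, h4, h2, Finset.subset_erase]
    tauto

/-- A terminal hypergraph of the process survives every other run of the process. -/
theorem verts_subset_of_reach {H K L : EssHypergraph V ι} (hK : H.IsStarCore K)
    (hL : Relation.ReflTransGen Step H L) : K.verts ⊆ L.verts := by
  induction hL with
  | refl => exact (reach_data hK.1).1
  | @tail L L' hL hs ih =>
    obtain ⟨v, hv, rfl⟩ := hs
    have hKd := reach_data hK.1
    have hLd := reach_data hL
    refine Finset.subset_erase.2 ⟨ih, fun hvK => hK.2 v ⟨hvK, fun e he hess => ?_⟩⟩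
    obtain ⟨he1, he2⟩ := (hKd.2.2.2 e).1 he
    refine hv.2 e ((hLd.2.2.2 e).2 ⟨he1, he2.trans ih⟩) ?_
    rw [hLd.2.2.1, ← hKd.2.2.1]
    exact hess

/-- The order of the deletions does not affect the outcome. -/
theorem isStarCore_unique {H K L : EssHypergraph V ι} (hK : H.IsStarCore K)
    (hL : H.IsStarCore L) : K = L := by
  have hv : K.verts = L.verts :=
    (verts_subset_of_reach hK hL.1).antisymm (verts_subset_of_reach hL hK.1)
  have hKd := reach_data hK.1
  have hLd := reach_data hL.1
  refine EssHypergraph.ext hv ?_ (hKd.2.1.trans hLd.2.1.symm) (hKd.2.2.1.trans hLd.2.2.1.symm)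
  ext e
  rw [hKd.2.2.2, hLd.2.2.2, hv]

/-- The *-core of `H`: the unique outcome of the *-core process. -/
def starCore (H : EssHypergraph V ι) : EssHypergraph V ι :=
  Classical.choose H.exists_isStarCore

theorem starCore_spec (H : EssHypergraph V ι) : H.IsStarCore H.starCore :=
  Classical.choose_spec H.exists_isStarCore

end EssHypergraph

open scoped Classical in
/-- The hypergraph `Γ(F, σ)`: its vertices are all the variables, and the variables of a constraint
form a hyperedge if that constraint has an essential variable, which is then the essential vertex of
the hyperedge. -/
def Gam (F : CSP k n M) (σ : Fin n → ℤˣ) : EssHypergraph (Fin n) (Fin M) where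
  verts := Finset.univ
  edges := Finset.univ.filter (fun a => ∃ x, IsEssential (F a) σ x)
  inc := fun a => Finset.univ.map (F a).2
  ess := fun a x => IsEssential (F a) σ x
  inc_subset := fun _ _ => Finset.subset_univ _

/-! ### The constants -/

/-- `α_k = inf_{x > 0} x / (1 - e^{-x})^{k-1}`. -/
def alphaK (k : ℕ) : ℝ :=
  sInf ((fun x : ℝ => x / (1 - Real.exp (-x)) ^ (k - 1)) '' Set.Ioi 0)

/-- `x_k(α)`, for `α > α_k`: the maximum `x ≥ 0` with `x / (1 - e^{-x})^{k-1} = α`. -/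
def xK (k : ℕ) (α : ℝ) : ℝ :=
  sSup {x : ℝ | 0 ≤ x ∧ x / (1 - Real.exp (-x)) ^ (k - 1) = α}

/-- `ρ_k(α) = 1 - e^{-x_k(α)}`. -/
def rhoK (k : ℕ) (α : ℝ) : ℝ := 1 - Real.exp (-xK k α)

end RandomCSP

end

/-!
The idea is to follow the deletion of removable vertices and to observe that, whatever the order,
it looks like a deletion in an order that is fixed in advance. Given the planted assignment `σ`, the
constraints are independent. At the cost of a factor
`exp (ε n)` in all probabilities, with `ε` as small as desired (`condPr_le_relPr`), the two values of `σ`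
can be taken as equally frequent, and the vertices at the positions of a constraint as independent and
uniform in the class of vertices with the prescribed sign (`CSPModel.relWeight`). A step of the process asks
only which of the non-essential positions contain the deleted vertex. Hence relabelling all
these positions by the order of deletion inside each sign class is an injective map that preserves
the product measure (`relabelTails_injective`, `relWeight_relabelTails`), and it turns the set of
vertices remaining after the deletion of `J s` vertices of each sign `s` into a set that depends on `J`
only (`supported_relabelTails`).

So it suffices to study, for each of the polynomially many values of `J`, the number of vertices that
are essential in a constraint whose other vertices all lie in a fixed set with density `y s` in
the class of sign `s`. By symmetry the essential vertex of a hyperedge is uniform over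
all vertices, so if all `y s` are equal to `y`, then with `α n` hyperedges the fraction of
supported vertices is about `1 - exp (-α y ^ (k - 1))`. The exponential moments of the number of
unsupported vertices are computed by adding the constraints one by one (`sum_exp_uncovered_le`),
which gives both tails with exponentially small error.

The vertices of the *-core are supported by each other. If the larger of the two densities of the core
is `y`, then monotonicity gives `y ≤ 1 - exp (-α y ^ (k - 1))`, up to a small error, and this fails for
all `y` above the largest fixed point `ρ` (`expUnlikely_large_core`); there is no positive fixed point
if `α < α_k`. Conversely, if the core is too small, consider the first time when the remaining
density in one of the classes has dropped to `y₀` slightly less than `ρ`. None of the deleted vertices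
is supported, so `y₀ ≥ 1 - exp (-α y₀ ^ (k - 1))`, up to a small error. But for `α > α_k` the opposite
strict inequality holds just below `ρ`, since `x / (1 - e^{-x})^{k-1}` is quasi-convex (`xK_crossing`,
`expUnlikely_small_core`).
-/

open Topology

noncomputable section

namespace RandomCSP

/-! ### The fixed-point equation `y = 1 - exp (-α y ^ (k - 1))` -/

lemma one_sub_exp_neg_pos {x : ℝ} (hx : 0 < x) : 0 < 1 - Real.exp (-x) := by
  have : Real.exp (-x) < 1 := by simpa using hx
  linarith

lemma one_sub_exp_neg_lt {k : ℕ} {α y : ℝ} (hy0 : 0 < y) (hy1 : y ≤ 1)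
    (h : y < 1 → α * y ^ (k - 1) < -Real.log (1 - y)) :
    1 - Real.exp (-(α * y ^ (k - 1))) < y := by
  rcases hy1.lt_or_eq with hy | rfl
  · have h1 : Real.exp (Real.log (1 - y)) < Real.exp (-(α * y ^ (k - 1))) :=
      Real.exp_lt_exp.2 (by linarith [h hy])
    rw [Real.exp_log (by linarith)] at h1
    linarith
  · linarith [Real.exp_pos (-(α * 1 ^ (k - 1)))]

lemma one_sub_exp_neg_lt_of_lt_alphaK {k : ℕ} {α : ℝ} (hα : α < alphaK k) {y : ℝ} (hy0 : 0 < y)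
    (hy1 : y ≤ 1) : 1 - Real.exp (-(α * y ^ (k - 1))) < y := by
  refine one_sub_exp_neg_lt hy0 hy1 fun hy => ?_
  have hx : 0 < -Real.log (1 - y) := by
    have := Real.log_neg (show 0 < 1 - y by linarith) (by linarith)
    linarith
  have hbdd : BddBelow ((fun x : ℝ => x / (1 - Real.exp (-x)) ^ (k - 1)) '' Set.Ioi 0) := by
    refine ⟨0, ?_⟩
    rintro _ ⟨x, hx, rfl⟩
    exact div_nonneg (le_of_lt hx) (pow_nonneg (one_sub_exp_neg_pos hx).le _)
  have h1 := csInf_le hbdd ⟨-Real.log (1 - y), hx, rfl⟩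
  have h2 : 1 - Real.exp (-(-Real.log (1 - y))) = y := by
    rw [neg_neg, Real.exp_log (by linarith)]; ring
  simp only [h2] at h1
  have h3 : α < -Real.log (1 - y) / y ^ (k - 1) := lt_of_lt_of_le hα h1
  rwa [lt_div_iff₀ (pow_pos hy0 _)] at h3

lemma div_exp_sub_one_antitone {x y : ℝ} (hx : 0 < x) (hxy : x ≤ y) :
    y / (Real.exp y - 1) ≤ x / (Real.exp x - 1) := by
  have h := convexOn_exp.secant_mono (a := 0) (x := x) (y := y) trivial trivial trivial hx.ne'
    (hx.trans_le hxy).ne' hxy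
  simp only [Real.exp_zero, sub_zero] at h
  have h1 : 0 < Real.exp x - 1 := by linarith [Real.add_one_lt_exp hx.ne']
  have h2 : 0 < Real.exp y - 1 := by linarith [Real.add_one_lt_exp (hx.trans_le hxy).ne']
  rw [div_le_div_iff₀ hx (hx.trans_le hxy)] at h
  rw [div_le_div_iff₀ h2 h1]
  linarith

/-- The function `x ↦ x / (1 - e^{-x})^{k-1}` is quasi-convex: if it takes a smaller value at `x₀`
than at `x₁ > x₀`, then it stays below the value at `x₁` in between. The logarithm of the function
has derivative `(1 - (k-1) x / (e^x - 1)) / x`, which changes sign at most once. -/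
lemma div_pow_lt_of_between (k : ℕ) {x₀ x x₁ : ℝ} (h0 : 0 < x₀) (h01 : x₀ < x) (h11 : x < x₁)
    (hlt : x₀ / (1 - Real.exp (-x₀)) ^ (k - 1) < x₁ / (1 - Real.exp (-x₁)) ^ (k - 1)) :
    x / (1 - Real.exp (-x)) ^ (k - 1) < x₁ / (1 - Real.exp (-x₁)) ^ (k - 1) := by
  set l : ℕ := k - 1
  let L : ℝ → ℝ := fun x => Real.log x - l * Real.log (1 - Real.exp (-x))
  have hpos : ∀ z : ℝ, 0 < z → 0 < z / (1 - Real.exp (-z)) ^ l := fun z hz =>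
    div_pos hz (pow_pos (one_sub_exp_neg_pos hz) _)
  have hL : ∀ z : ℝ, 0 < z → Real.log (z / (1 - Real.exp (-z)) ^ l) = L z := fun z hz => by
    simp only [L]
    rw [Real.log_div hz.ne' (pow_pos (one_sub_exp_neg_pos hz) _).ne', Real.log_pow]
  have hd : ∀ z : ℝ, 0 < z → HasDerivAt L ((1 - l * (z / (Real.exp z - 1))) / z) z := by
    intro z hz
    have h1 := one_sub_exp_neg_pos hz
    have h2 : HasDerivAt (fun z : ℝ => 1 - Real.exp (-z)) (Real.exp (-z)) z := by
      have := ((hasDerivAt_neg z).exp).const_sub 1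
      simpa using this
    have h3 := (Real.hasDerivAt_log hz.ne').sub ((h2.log h1.ne').const_mul (l : ℝ))
    refine h3.congr_deriv ?_
    have h4 : Real.exp z - 1 ≠ 0 := by linarith [Real.add_one_lt_exp hz.ne']
    have h5 : Real.exp (-z) / (1 - Real.exp (-z)) = 1 / (Real.exp z - 1) := by
      rw [div_eq_div_iff h1.ne' h4, mul_sub, ← Real.exp_add]; simp
    rw [h5]
    field_simp
  have hx : 0 < x := h0.trans h01
  have hx1 : 0 < x₁ := hx.trans h11
  by_contra hcon
  push Not at hcon
  have a1 : L x₀ < L x₁ := by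
    rw [← hL _ h0, ← hL _ hx1]; exact Real.log_lt_log (hpos _ h0) hlt
  have a2 : L x₁ ≤ L x := by
    rw [← hL _ hx, ← hL _ hx1]; exact Real.log_le_log (hpos _ hx1) hcon
  obtain ⟨c, hc, hc'⟩ := exists_hasDerivAt_eq_slope L _ h01
    (fun z hz => (hd z (h0.trans_le hz.1)).continuousAt.continuousWithinAt)
    (fun z hz => hd z (h0.trans hz.1))
  obtain ⟨d, hdd, hd'⟩ := exists_hasDerivAt_eq_slope L _ h11
    (fun z hz => (hd z (hx.trans_le hz.1)).continuousAt.continuousWithinAt)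
    (fun z hz => hd z (hx.trans hz.1))
  have hc0 : 0 < c := h0.trans hc.1
  have hd0 : 0 < d := hx.trans hdd.1
  have b1 : 0 < (1 - l * (c / (Real.exp c - 1))) / c := by
    rw [hc']; exact div_pos (by linarith) (by linarith)
  have b2 : (1 - l * (d / (Real.exp d - 1))) / d ≤ 0 := by
    rw [hd']; exact div_nonpos_of_nonpos_of_nonneg (by linarith) (by linarith)
  have b3 : 0 < 1 - l * (c / (Real.exp c - 1)) := by
    rcases div_pos_iff.1 b1 with h | h
    · exact h.1
    · linarith
  have b4 : 1 - l * (d / (Real.exp d - 1)) ≤ 0 := by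
    by_contra hh
    push Not at hh
    linarith [div_pos hh hd0]
  have b5 := mul_le_mul_of_nonneg_left
    (div_exp_sub_one_antitone hc0 (hc.2.trans hdd.1).le) (Nat.cast_nonneg (α := ℝ) l)
  linarith

lemma alphaK_nonneg (k : ℕ) : 0 ≤ alphaK k := by
  refine Real.sInf_nonneg ?_
  rintro _ ⟨x, hx, rfl⟩
  exact div_nonneg (le_of_lt hx) (pow_nonneg (one_sub_exp_neg_pos hx).le _)

lemma le_div_pow_one_sub_exp_neg (k : ℕ) {x : ℝ} (hx : 0 < x) :
    x ≤ x / (1 - Real.exp (-x)) ^ (k - 1) := by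
  have h1 := one_sub_exp_neg_pos hx
  rw [le_div_iff₀ (pow_pos h1 _)]
  exact mul_le_of_le_one_right hx.le
    (pow_le_one₀ h1.le (by linarith [Real.exp_pos (-x)]))

/-- Above the threshold, `x_k(α)` is a root at which `x / (1 - e^{-x})^{k-1}` crosses the level `α`
from below. -/
lemma xK_crossing {k : ℕ} {α : ℝ} (hα : alphaK k < α) :
    ∃ x₀ : ℝ, 0 < x₀ ∧ x₀ < xK k α ∧
      (∀ x, x₀ < x → x < xK k α → x / (1 - Real.exp (-x)) ^ (k - 1) < α) ∧
      ∀ x, xK k α < x → α < x / (1 - Real.exp (-x)) ^ (k - 1) := by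
  set ψ : ℝ → ℝ := fun x => x / (1 - Real.exp (-x)) ^ (k - 1) with hψ
  have hne : (ψ '' Set.Ioi 0).Nonempty := ⟨_, 1, by simp, rfl⟩
  obtain ⟨_, ⟨x₀, hx₀, rfl⟩, hx₀α⟩ := exists_lt_of_csInf_lt hne hα
  have hx₀ : 0 < x₀ := hx₀
  have hcont : ∀ x : ℝ, 0 < x → ContinuousAt ψ x := fun x hx => by
    have h1 := (pow_pos (one_sub_exp_neg_pos hx) (k - 1)).ne'
    simp only [hψ]
    fun_prop (disch := assumption)
  -- beyond any point where the function is below `α` there is a root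
  have hroot : ∀ x : ℝ, 0 < x → ψ x < α → ∃ z, x ≤ z ∧ z ≤ α ∧ ψ z = α := by
    intro x hx hxα
    have h1 : x ≤ α := (le_div_pow_one_sub_exp_neg k hx).trans hxα.le
    have h2 := intermediate_value_Icc h1
      (fun z hz => (hcont z (hx.trans_le hz.1)).continuousWithinAt)
    obtain ⟨z, hz, hz'⟩ := h2 ⟨hxα.le, le_div_pow_one_sub_exp_neg k (hx.trans_le h1)⟩
    exact ⟨z, hz.1, hz.2, hz'⟩
  have hcomp : IsCompact (Set.Icc x₀ α ∩ ψ ⁻¹' {α}) := by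
    refine isCompact_Icc.of_isClosed_subset ?_ Set.inter_subset_left
    exact ContinuousOn.preimage_isClosed_of_isClosed
      (fun z hz => (hcont z (hx₀.trans_le hz.1)).continuousWithinAt) isClosed_Icc isClosed_singleton
  obtain ⟨z, hz1, hz2, hz3⟩ := hroot x₀ hx₀ hx₀α
  obtain ⟨x₁, hx₁, hmax⟩ := hcomp.exists_isGreatest ⟨z, ⟨hz1, hz2⟩, hz3⟩
  have hx₁0 : 0 < x₁ := hx₀.trans_le hx₁.1.1
  have hx₁α : ψ x₁ = α := hx₁.2
  have hgr : IsGreatest {x : ℝ | 0 ≤ x ∧ x / (1 - Real.exp (-x)) ^ (k - 1) = α} x₁ := by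
    refine ⟨⟨hx₁0.le, hx₁α⟩, fun y hy => ?_⟩
    by_contra hlt
    push Not at hlt
    refine hlt.not_ge (hmax ⟨⟨hx₁.1.1.trans hlt.le, ?_⟩, hy.2⟩)
    exact (le_div_pow_one_sub_exp_neg k (hx₁0.trans hlt)).trans hy.2.le
  have hxK : xK k α = x₁ := hgr.csSup_eq
  have hlt01 : x₀ < x₁ := lt_of_le_of_ne hx₁.1.1 (by rintro rfl; exact hx₀α.ne hx₁α)
  rw [hxK]
  refine ⟨x₀, hx₀, hlt01, fun x h0 h1 => ?_, fun x hx => ?_⟩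
  · rw [← hx₁α]
    exact div_pow_lt_of_between k hx₀ h0 h1 (by rw [← hx₁α] at hx₀α; exact hx₀α)
  · by_contra hcon
    push Not at hcon
    have hx0 := hx₁0.trans hx
    rcases hcon.lt_or_eq with h | h
    · obtain ⟨w, hw1, hw2, hw3⟩ := hroot x hx0 h
      exact (hx.trans_le hw1).not_ge (hgr.2 ⟨(hx0.trans_le hw1).le, hw3⟩)
    · exact hx.not_ge (hgr.2 ⟨hx0.le, h⟩)

lemma rhoK_pos {k : ℕ} {α : ℝ} (hα : alphaK k < α) : 0 < rhoK k α := by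
  obtain ⟨x₀, h0, h1, -⟩ := xK_crossing hα
  exact one_sub_exp_neg_pos (h0.trans h1)

lemma one_sub_exp_neg_lt_of_rhoK_lt {k : ℕ} {α : ℝ} (hα : alphaK k < α) {y : ℝ}
    (hy0 : rhoK k α < y) (hy1 : y ≤ 1) : 1 - Real.exp (-(α * y ^ (k - 1))) < y := by
  have hy := (rhoK_pos hα).trans hy0
  refine one_sub_exp_neg_lt hy hy1 fun hlt => ?_
  obtain ⟨x₀, h0, h1, -, h2⟩ := xK_crossing hα
  have h3 : xK k α < -Real.log (1 - y) := by
    have : Real.log (1 - y) < Real.log (Real.exp (-xK k α)) :=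
      Real.log_lt_log (by linarith) (by unfold rhoK at hy0; linarith)
    rw [Real.log_exp] at this
    linarith
  have h4 := h2 _ h3
  have h5 : 1 - Real.exp (-(-Real.log (1 - y))) = y := by
    rw [neg_neg, Real.exp_log (by linarith)]; ring
  rwa [h5, lt_div_iff₀ (pow_pos hy _)] at h4

lemma exists_lt_one_sub_exp_neg {k : ℕ} {α : ℝ} (hα : alphaK k < α) {ε : ℝ} (hε : 0 < ε) :
    ∃ y, 0 < y ∧ y < 1 ∧ rhoK k α - ε < y ∧ y < 1 - Real.exp (-(α * y ^ (k - 1))) := by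
  obtain ⟨x₀, h0, h1, h2, -⟩ := xK_crossing hα
  set x₁ := xK k α
  have hm : max x₀ (x₁ - ε) < x₁ := max_lt h1 (by linarith)
  obtain ⟨x, hx, hx'⟩ := exists_between hm
  have hx0 : x₀ < x := (le_max_left _ _).trans_lt hx
  have hxε : x₁ - ε < x := (le_max_right _ _).trans_lt hx
  have hxpos := h0.trans hx0
  have hpos := one_sub_exp_neg_pos hxpos
  refine ⟨1 - Real.exp (-x), hpos, by linarith [Real.exp_pos (-x)], ?_, ?_⟩
  · have e1 : Real.exp (-x) - Real.exp (-x₁) ≤ x₁ - x := by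
      have e2 : Real.exp (-x₁) = Real.exp (-x) * Real.exp (-(x₁ - x)) := by
        rw [← Real.exp_add]; ring_nf
      have e3 := Real.add_one_le_exp (-(x₁ - x))
      have e4 : Real.exp (-x) ≤ 1 := Real.exp_le_one_iff.2 (by linarith)
      nlinarith [Real.exp_pos (-x)]
    have : rhoK k α = 1 - Real.exp (-x₁) := rfl
    linarith
  · have h3 := h2 x hx0 hx'
    rw [div_lt_iff₀ (pow_pos hpos _)] at h3
    have := Real.exp_lt_exp.2 (neg_lt_neg h3)
    linarith

variable {k n M : ℕ}

/-! ### Deletion chains and ranks -/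

section Chain

variable {V : Type*} [Fintype V]

/-- The vertices with sign `s`. -/
def signClass (σ : V → ℤˣ) (s : ℤˣ) : Finset V := Finset.univ.filter fun v => σ v = s

@[simp] lemma mem_signClass {σ : V → ℤˣ} {s : ℤˣ} {v : V} : v ∈ signClass σ s ↔ σ v = s := by
  simp [signClass]

/-- The number of vertices with the sign of `v` that precede `v` in the deletion chain `D`. -/
def chainRank (σ : V → ℤˣ) (D : ℕ → Finset V) (v : V) : ℕ :=
  open scoped Classical in
  (Finset.univ.filter fun w => σ w = σ v ∧ ∃ j, w ∈ D j ∧ v ∉ D j).card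

lemma chainRank_lt_card (σ : V → ℤˣ) (D : ℕ → Finset V) (v : V) :
    chainRank σ D v < (signClass σ (σ v)).card := by
  classical
  unfold chainRank
  refine Finset.card_lt_card ((Finset.ssubset_iff_of_subset fun w hw => ?_).2 ⟨v, ?_, ?_⟩)
  · simp only [Finset.mem_filter] at hw
    simpa using hw.2.1
  · simp
  · simp

variable [DecidableEq V]

/-- The vertex (as a finset with at most one element) to be deleted after those in `D`: if possible
one outside `C`. The choice depends on `D` and `C` only. -/
def pick (D C : Finset V) : Finset V :=
  if h : (Dᶜ \ C).Nonempty then {h.choose} else if h : Dᶜ.Nonempty then {h.choose} else ∅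

/-- The sets of the first `j` deleted vertices, where a vertex outside `C D` is preferred as the
one to be deleted after those in `D`. When there is none, an arbitrary vertex is deleted. -/
def delChain (C : Finset V → Finset V) : ℕ → Finset V
  | 0 => ∅
  | j + 1 => delChain C j ∪ pick (delChain C j) (C (delChain C j))

lemma card_pick_le (D C : Finset V) : (pick D C).card ≤ 1 := by
  unfold pick; split_ifs <;> simp

lemma pick_disjoint (D C : Finset V) : Disjoint D (pick D C) := by
  unfold pick
  split_ifs with h1 h2
  · have := h1.choose_spec
    simp only [Finset.mem_sdiff, Finset.mem_compl] at this
    simpa using this.1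
  · simpa using h2.choose_spec
  · simp

lemma pick_subset_sdiff {D C : Finset V} (h : (Dᶜ \ C).Nonempty) : pick D C ⊆ Dᶜ \ C := by
  unfold pick
  rw [dif_pos h]
  simpa using h.choose_spec

lemma pick_nonempty {D C : Finset V} (h : Dᶜ.Nonempty) : (pick D C).Nonempty := by
  unfold pick
  split_ifs <;> simp

lemma delChain_mono (C : Finset V → Finset V) : Monotone (delChain C) :=
  monotone_nat_of_le_succ fun _ => Finset.subset_union_left

lemma exists_delChain_eq_univ (C : Finset V → Finset V) : ∃ j, delChain C j = Finset.univ := by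
  by_contra hcon
  push Not at hcon
  have h : ∀ j, j ≤ (delChain C j).card := by
    intro j
    induction j with
    | zero => simp
    | succ j ih =>
      have h1 : (delChain C j)ᶜ.Nonempty := by
        rw [Finset.nonempty_iff_ne_empty, Ne, Finset.compl_eq_empty_iff]; exact hcon j
      have h2 := (pick_nonempty (C := C (delChain C j)) h1).card_pos
      simp only [delChain]
      rw [Finset.card_union_of_disjoint (pick_disjoint _ _)]
      omega
  have h1 := h (Fintype.card V + 1)
  have h2 := Finset.card_le_univ (delChain C (Fintype.card V + 1))
  omega

lemma chainRank_lt_iff (σ : V → ℤˣ) {D : ℕ → Finset V} (hD : Monotone D) (j : ℕ) (v : V) :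
    chainRank σ D v < (D j ∩ signClass σ (σ v)).card ↔ v ∈ D j := by
  classical
  unfold chainRank
  constructor
  · intro h
    by_contra hv
    refine h.not_ge (Finset.card_le_card fun w hw => ?_)
    simp only [Finset.mem_inter, mem_signClass] at hw
    simp only [Finset.mem_filter, Finset.mem_univ, true_and]
    exact ⟨hw.2, j, hw.1, hv⟩
  · intro hv
    refine Finset.card_lt_card ((Finset.ssubset_iff_of_subset fun w hw => ?_).2 ⟨v, ?_, ?_⟩)
    · simp only [Finset.mem_filter, Finset.mem_univ, true_and] at hw
      obtain ⟨hw1, i, hi, hi'⟩ := hw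
      have hij : i ≤ j := by
        by_contra hij
        exact hi' (hD (not_le.1 hij).le hv)
      simp only [Finset.mem_inter, mem_signClass]
      exact ⟨hD hij hi, hw1⟩
    · simpa using hv
    · simp

/-- As one vertex is deleted at a time, any two vertices are separated by the chain. -/
lemma delChain_separates (C : Finset V → Finset V) {v w : V} (hvw : v ≠ w) :
    ∃ j, ¬ (v ∈ delChain C j ↔ w ∈ delChain C j) := by
  classical
  by_contra hcon
  push Not at hcon
  have hex : ∃ j, v ∈ delChain C j := by
    obtain ⟨j, hj⟩ := exists_delChain_eq_univ C
    exact ⟨j, by simp [hj]⟩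
  have h1 := Nat.find_spec hex
  have h2 := fun i hi => Nat.find_min hex (m := i) hi
  obtain ⟨i, hi⟩ : ∃ i, Nat.find hex = i + 1 := by
    refine Nat.exists_eq_succ_of_ne_zero fun h0 => ?_
    rw [h0] at h1
    simp [delChain] at h1
  have h3 := h2 i (by omega)
  have h3' : w ∉ delChain C i := by rwa [← hcon i]
  have h4 := (hcon _).1 h1
  rw [hi] at h1 h4
  simp only [delChain, Finset.mem_union, h3, h3', false_or] at h1 h4
  exact hvw (Finset.card_le_one.1 (card_pick_le _ _) _ h1 _ h4)

lemma chainRank_injOn (σ : V → ℤˣ) (C : Finset V → Finset V) {v w : V} (hs : σ v = σ w)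
    (h : chainRank σ (delChain C) v = chainRank σ (delChain C) w) : v = w := by
  by_contra hvw
  obtain ⟨j, hj⟩ := delChain_separates C hvw
  refine hj ?_
  rw [← chainRank_lt_iff σ (delChain_mono C), ← chainRank_lt_iff σ (delChain_mono C), h, hs]

/-- The rank of a vertex inside its sign class, in a fixed order of the vertices. -/
def classIndex (σ : V → ℤˣ) (v : V) : ℕ := chainRank σ (delChain fun _ => ∅) v

lemma image_classIndex (σ : V → ℤˣ) (s : ℤˣ) :
    (signClass σ s).image (classIndex σ) = Finset.range (signClass σ s).card := by
  refine Finset.eq_of_subset_of_card_le ?_ ?_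
  · intro i hi
    obtain ⟨v, hv, rfl⟩ := Finset.mem_image.1 hi
    rw [mem_signClass] at hv
    subst hv
    exact Finset.mem_range.2 (chainRank_lt_card σ _ v)
  · rw [Finset.card_range, Finset.card_image_of_injOn]
    intro v hv w hw h
    simp only [Finset.mem_coe, mem_signClass] at hv hw
    exact chainRank_injOn σ _ (hv.trans hw.symm) h

/-- The vertices whose index inside their sign class is at least `J s`, for either sign `s`. -/
def laterVerts (σ : V → ℤˣ) (J : ℤˣ → ℕ) : Finset V :=
  Finset.univ.filter fun v => J (σ v) ≤ classIndex σ v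

lemma card_laterVerts_inter (σ : V → ℤˣ) (J : ℤˣ → ℕ) (s : ℤˣ) :
    (laterVerts σ J ∩ signClass σ s).card = (signClass σ s).card - J s := by
  have h1 : ((laterVerts σ J ∩ signClass σ s).image (classIndex σ)) =
      (Finset.range (signClass σ s).card).filter fun i => J s ≤ i := by
    rw [← image_classIndex, Finset.filter_image]
    congr 1
    ext v
    simp only [laterVerts, Finset.mem_inter, Finset.mem_filter, Finset.mem_univ, true_and,
      mem_signClass]
    constructor
    · rintro ⟨h, rfl⟩; exact ⟨rfl, h⟩
    · rintro ⟨rfl, h⟩; exact ⟨h, rfl⟩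
  have h2 : ((laterVerts σ J ∩ signClass σ s).image (classIndex σ)).card =
      (laterVerts σ J ∩ signClass σ s).card := by
    refine Finset.card_image_of_injOn fun v hv w hw h => ?_
    simp only [Finset.coe_inter, Set.mem_inter_iff, Finset.mem_coe, mem_signClass] at hv hw
    exact chainRank_injOn σ _ (hv.2.trans hw.2.symm) h
  rw [← h2, h1]
  have h3 : ((Finset.range (signClass σ s).card).filter fun i => J s ≤ i) =
      Finset.Ico (J s) (signClass σ s).card := by
    ext i; simp; tauto
  rw [h3, Nat.card_Ico]

lemma exists_classIndex_eq (σ : V → ℤˣ) (D : ℕ → Finset V) (v : V) :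
    ∃ w, σ w = σ v ∧ classIndex σ w = chainRank σ D v := by
  have h := chainRank_lt_card σ D v
  rw [← Finset.mem_range, ← image_classIndex] at h
  obtain ⟨w, hw, hw'⟩ := Finset.mem_image.1 h
  exact ⟨w, by simpa using hw, hw'⟩

/-- The map that takes the `i`-th deleted vertex of a sign class to the `i`-th vertex of this class
in the fixed order. -/
def relabel (σ : V → ℤˣ) (D : ℕ → Finset V) (v : V) : V := (exists_classIndex_eq σ D v).choose

lemma sign_relabel (σ : V → ℤˣ) (D : ℕ → Finset V) (v : V) : σ (relabel σ D v) = σ v :=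
  (exists_classIndex_eq σ D v).choose_spec.1

lemma classIndex_relabel (σ : V → ℤˣ) (D : ℕ → Finset V) (v : V) :
    classIndex σ (relabel σ D v) = chainRank σ D v :=
  (exists_classIndex_eq σ D v).choose_spec.2

lemma relabel_injective (σ : V → ℤˣ) (C : Finset V → Finset V) :
    Function.Injective (relabel σ (delChain C)) := by
  intro v w h
  refine chainRank_injOn σ C ?_ ?_
  · have h1 := sign_relabel σ (delChain C) v
    rw [h, sign_relabel σ] at h1
    exact h1.symm
  · rw [← classIndex_relabel, h, classIndex_relabel]

/-- The numbers of vertices of either sign in a set. -/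
def signCount (σ : V → ℤˣ) (D : Finset V) (s : ℤˣ) : ℕ := (D ∩ signClass σ s).card

lemma relabel_mem_laterVerts (σ : V → ℤˣ) {D : ℕ → Finset V} (hD : Monotone D) (j : ℕ) (v : V) :
    relabel σ D v ∈ laterVerts σ (signCount σ (D j)) ↔ v ∉ D j := by
  rw [← chainRank_lt_iff σ hD]
  rw [laterVerts, Finset.mem_filter_univ, classIndex_relabel, sign_relabel σ, signCount, not_lt]

end Chain

/-! ### Supported vertices, and relabelling along the deletion process -/

/-- A constraint in which variables may be repeated. -/
abbrev RelConstraint (k n : ℕ) : Type := BoolFn k × (Fin k → Fin n)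

/-- The `i`-th argument is essential for `φ` at its satisfying assignment `s`. -/
def EssPos (φ : BoolFn k) (s : Fin k → ℤˣ) (i : Fin k) : Prop :=
  φ s = true ∧ φ (flipAt s i) = false

/-- The `i`-th argument of the constraint `c` is essential under `σ`. -/
def EssAt (σ : Fin n → ℤˣ) (c : RelConstraint k n) (i : Fin k) : Prop :=
  EssPos c.1 (fun a => σ (c.2 a)) i

/-- Some argument of the constraint `c` is essential under `σ`. -/
def HasEss (σ : Fin n → ℤˣ) (c : RelConstraint k n) : Prop := ∃ i, EssAt σ c i

/-- The vertices that are essential in the constraint `c`, provided that the vertices at all the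
other positions of `c` (those that are not essential) lie in `A`. -/
def heads (σ : Fin n → ℤˣ) (A : Finset (Fin n)) (c : RelConstraint k n) : Finset (Fin n) :=
  open scoped Classical in
  Finset.univ.filter fun v =>
    ∃ i, EssAt σ c i ∧ c.2 i = v ∧ ∀ a, ¬ EssAt σ c a → c.2 a ∈ A

/-- The vertices that are essential in a constraint of `F` all of whose other vertices
lie in `A`. -/
def supported {ι : Type*} (σ : Fin n → ℤˣ) (A : Finset (Fin n)) (F : ι → RelConstraint k n) :
    Finset (Fin n) :=
  open scoped Classical in
  Finset.univ.filter fun v => ∃ e, v ∈ heads σ A (F e)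

variable {ι : Type*}

lemma mem_heads {σ : Fin n → ℤˣ} {A : Finset (Fin n)} {c : RelConstraint k n} {v : Fin n} :
    v ∈ heads σ A c ↔ ∃ i, EssAt σ c i ∧ c.2 i = v ∧ ∀ a, ¬ EssAt σ c a → c.2 a ∈ A := by
  simp [heads]

lemma mem_supported {σ : Fin n → ℤˣ} {A : Finset (Fin n)} {F : ι → RelConstraint k n}
    {v : Fin n} : v ∈ supported σ A F ↔ ∃ e, v ∈ heads σ A (F e) := by
  simp [supported]

lemma supported_mono (σ : Fin n → ℤˣ) (F : ι → RelConstraint k n) {A B : Finset (Fin n)}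
    (h : A ⊆ B) : supported σ A F ⊆ supported σ B F := by
  intro v hv
  rw [mem_supported] at hv ⊢
  obtain ⟨e, he⟩ := hv
  rw [mem_heads] at he
  obtain ⟨i, h1, h2, h3⟩ := he
  exact ⟨e, mem_heads.2 ⟨i, h1, h2, fun a ha => h (h3 a ha)⟩⟩

/-- The deletion chain of `F`: vertices that are not supported by the remaining ones are deleted one
after the other and, when there is none left, arbitrary vertices. -/
def coreChain (σ : Fin n → ℤˣ) (F : ι → RelConstraint k n) : ℕ → Finset (Fin n) :=
  delChain fun D => supported σ Dᶜ F

open scoped Classical in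
/-- All the vertices at positions that are not essential are relabelled in the order of their
deletion. -/
def relabelTails (σ : Fin n → ℤˣ) (F : ι → RelConstraint k n) (e : ι) : RelConstraint k n :=
  ((F e).1, fun a => if EssAt σ (F e) a then (F e).2 a else relabel σ (coreChain σ F) ((F e).2 a))

@[simp] lemma fst_relabelTails (σ : Fin n → ℤˣ) (F : ι → RelConstraint k n) (e : ι) :
    (relabelTails σ F e).1 = (F e).1 := rfl

lemma sign_relabelTails (σ : Fin n → ℤˣ) (F : ι → RelConstraint k n) (e : ι) (a : Fin k) :
    σ ((relabelTails σ F e).2 a) = σ ((F e).2 a) := by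
  simp only [relabelTails]
  split_ifs
  · rfl
  · exact sign_relabel _ _ _

@[simp] lemma essAt_relabelTails (σ : Fin n → ℤˣ) (F : ι → RelConstraint k n) (e : ι) (a : Fin k) :
    EssAt σ (relabelTails σ F e) a ↔ EssAt σ (F e) a := by
  simp only [EssAt, sign_relabelTails, fst_relabelTails]

lemma relabelTails_of_essAt {σ : Fin n → ℤˣ} {F : ι → RelConstraint k n} {e : ι} {a : Fin k}
    (h : EssAt σ (F e) a) : (relabelTails σ F e).2 a = (F e).2 a := by
  simp [relabelTails, h]

lemma relabelTails_of_not_essAt {σ : Fin n → ℤˣ} {F : ι → RelConstraint k n} {e : ι} {a : Fin k}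
    (h : ¬ EssAt σ (F e) a) :
    (relabelTails σ F e).2 a = relabel σ (coreChain σ F) ((F e).2 a) := by
  simp [relabelTails, h]

/-- After the relabelling, the vertices supported by the remaining ones are determined by
the numbers of deleted vertices of either sign. -/
lemma supported_relabelTails (σ : Fin n → ℤˣ) (F : ι → RelConstraint k n) (j : ℕ) :
    supported σ (laterVerts σ (signCount σ (coreChain σ F j))) (relabelTails σ F) =
      supported σ (coreChain σ F j)ᶜ F := by
  ext v
  simp only [mem_supported, mem_heads, essAt_relabelTails]
  refine exists_congr fun e => exists_congr fun i => and_congr_right fun hi => ?_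
  rw [relabelTails_of_essAt hi]
  refine and_congr_right fun _ => forall_congr' fun a => imp_congr_right fun ha => ?_
  rw [relabelTails_of_not_essAt ha, coreChain, relabel_mem_laterVerts σ (delChain_mono _),
    Finset.mem_compl]

/-- The relabelling loses no information: each deletion of the process depends only on
the relabelled instance and the previous deletions. -/
lemma relabelTails_injective (σ : Fin n → ℤˣ) :
    Function.Injective (relabelTails σ : (ι → RelConstraint k n) → ι → RelConstraint k n) := by
  intro F G h
  have hchain : coreChain σ F = coreChain σ G := by
    ext1 j
    induction j with
    | zero => rfl
    | succ j ih =>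
      have h1 : supported σ (coreChain σ F j)ᶜ F = supported σ (coreChain σ G j)ᶜ G := by
        rw [← supported_relabelTails, ← supported_relabelTails, h, ih]
      change coreChain σ F j ∪ pick (coreChain σ F j) (supported σ (coreChain σ F j)ᶜ F) =
        coreChain σ G j ∪ pick (coreChain σ G j) (supported σ (coreChain σ G j)ᶜ G)
      rw [h1, ih]
  ext1 e
  refine Prod.ext ?_ ?_
  · rw [← fst_relabelTails σ F, h, fst_relabelTails]
  · ext1 a
    have hess : EssAt σ (F e) a ↔ EssAt σ (G e) a := by
      rw [← essAt_relabelTails, h, essAt_relabelTails]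
    by_cases ha : EssAt σ (F e) a
    · rw [← relabelTails_of_essAt ha, h, relabelTails_of_essAt (hess.1 ha)]
    · have h1 := relabelTails_of_not_essAt ha
      rw [h, relabelTails_of_not_essAt (fun h => ha (hess.2 h)), hchain] at h1
      exact (relabel_injective σ _ h1).symm

/-! ### The *-core as the outcome of the deletion chain -/

/-- The instance with the same constraints in which repeated variables would be allowed. -/
def CSP.toRel (F : CSP k n M) (e : Fin M) : RelConstraint k n := ((F e).1, fun a => (F e).2 a)

/-- In every satisfied constraint at most one position is essential. -/
def UniqueEss (σ : Fin n → ℤˣ) (c : RelConstraint k n) : Prop :=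
  ∀ i j, EssAt σ c i → EssAt σ c j → i = j

lemma isEssential_iff (F : CSP k n M) (σ : Fin n → ℤˣ) (e : Fin M) (v : Fin n) :
    IsEssential (F e) σ v ↔ ∃ i, EssAt σ (F.toRel e) i ∧ (F.toRel e).2 i = v := by
  have hflip : ∀ i, (fun a => flipAt σ ((F e).2 i) ((F e).2 a)) =
      flipAt (fun a => σ ((F e).2 a)) i := by
    intro i
    ext1 a
    by_cases h : a = i
    · subst h; simp [flipAt]
    · simp [flipAt, h]
  simp only [IsEssential, Constraint.eval, EssAt, EssPos, CSP.toRel]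
  constructor
  · rintro ⟨h1, h2⟩
    by_cases hv : ∃ i, (F e).2 i = v
    · obtain ⟨i, rfl⟩ := hv
      rw [hflip] at h2
      exact ⟨i, ⟨h1, h2⟩, rfl⟩
    · exfalso
      have : (fun a => flipAt σ v ((F e).2 a)) = fun a => σ ((F e).2 a) := by
        ext1 a
        have : (F e).2 a ≠ v := fun h => hv ⟨a, h⟩
        simp [flipAt, this]
      rw [this, h1] at h2
      exact Bool.noConfusion h2
  · rintro ⟨i, ⟨h1, h2⟩, rfl⟩
    exact ⟨h1, by rw [hflip]; exact h2⟩

lemma gam_edges (F : CSP k n M) (σ : Fin n → ℤˣ) (e : Fin M) :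
    e ∈ (Gam F σ).edges ↔ HasEss σ (F.toRel e) := by
  simp only [HasEss, Gam, Finset.mem_filter, Finset.mem_univ, true_and, isEssential_iff]
  exact ⟨fun ⟨_, i, h, _⟩ => ⟨i, h⟩, fun ⟨i, h⟩ => ⟨_, i, h, rfl⟩⟩

open EssHypergraph in
/-- Until the first time `N` at which all the remaining vertices are supported by the remaining
ones, the deletion chain is a run of the *-core process, and what is then left is the *-core. -/
lemma exists_starCore_eq (F : CSP k n M) (σ : Fin n → ℤˣ) (hF : ∀ e, UniqueEss σ (F.toRel e)) :
    ∃ N, (Gam F σ).starCore.verts = (coreChain σ F.toRel N)ᶜ ∧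
      (coreChain σ F.toRel N)ᶜ ⊆ supported σ (coreChain σ F.toRel N)ᶜ F.toRel ∧
      ∀ j ≤ N, Disjoint (coreChain σ F.toRel j) (supported σ (coreChain σ F.toRel j)ᶜ F.toRel) := by
  classical
  set D := coreChain σ F.toRel with hD
  have hstep : ∀ j, D (j + 1) = D j ∪ pick (D j) (supported σ (D j)ᶜ F.toRel) := fun j => rfl
  have hex : ∃ N, (D N)ᶜ ⊆ supported σ (D N)ᶜ F.toRel := by
    obtain ⟨N, hN⟩ := exists_delChain_eq_univ fun D => supported σ Dᶜ F.toRel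
    have hN : D N = Finset.univ := hN
    exact ⟨N, by simp [hN]⟩
  have hpick : ∀ j < Nat.find hex, ∃ v, v ∉ D j ∧ v ∉ supported σ (D j)ᶜ F.toRel ∧
      D (j + 1) = D j ∪ {v} := by
    intro j hj
    have h1 := Nat.find_min hex hj
    have h2 : ((D j)ᶜ \ supported σ (D j)ᶜ F.toRel).Nonempty := Finset.sdiff_nonempty.2 h1
    have h2' : (D j)ᶜ.Nonempty := h2.mono Finset.sdiff_subset
    obtain ⟨v, hv⟩ := pick_nonempty (C := supported σ (D j)ᶜ F.toRel) h2'
    have h3 := pick_subset_sdiff h2 hv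
    rw [Finset.mem_sdiff, Finset.mem_compl] at h3
    refine ⟨v, h3.1, h3.2, ?_⟩
    rw [hstep]
    congr 1
    exact Finset.eq_singleton_iff_unique_mem.2
      ⟨hv, fun w hw => Finset.card_le_one.1 (card_pick_le _ _) _ hw _ hv⟩
  have hmono : Monotone D := delChain_mono _
  have hreach : ∀ j ≤ Nat.find hex, ∃ L, Relation.ReflTransGen Step (Gam F σ) L ∧
      L.verts = (D j)ᶜ := by
    intro j
    induction j with
    | zero => exact fun _ => ⟨Gam F σ, .refl, by simp [Gam, hD, coreChain, delChain]⟩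
    | succ j ih =>
      intro hj
      obtain ⟨L, hL, hLv⟩ := ih (by omega)
      obtain ⟨v, hv1, hv2, hv3⟩ := hpick j (by omega)
      obtain ⟨-, hinc, hess, hedges⟩ := reach_data hL
      refine ⟨L.deleteVertex v, hL.tail ⟨v, ⟨by simpa [hLv] using hv1, fun e he hev => hv2 ?_⟩,
        rfl⟩, ?_⟩
      · rw [hess] at hev
        obtain ⟨i, hi, hiv⟩ := (isEssential_iff F σ e v).1 hev
        refine mem_supported.2 ⟨e, mem_heads.2 ⟨i, hi, hiv, fun a _ => ?_⟩⟩
        rw [← hLv]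
        exact ((hedges e).1 he).2 (Finset.mem_map_of_mem _ (Finset.mem_univ a))
      · rw [hv3]
        ext w
        simp [deleteVertex, hLv]
  refine ⟨Nat.find hex, ?_, Nat.find_spec hex, ?_⟩
  · obtain ⟨L, hL, hLv⟩ := hreach _ le_rfl
    have hcore : (Gam F σ).IsStarCore L := by
      refine ⟨hL, fun v hv => ?_⟩
      obtain ⟨-, hinc, hess, hedges⟩ := reach_data hL
      have hv1 := hv.1
      rw [hLv] at hv1
      obtain ⟨e, he⟩ := mem_supported.1 (Nat.find_spec hex hv1)
      obtain ⟨i, hi, hiv, ha⟩ := mem_heads.1 he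
      refine hv.2 e ((hedges e).2 ⟨(gam_edges F σ e).2 ⟨i, hi⟩, fun w hw => ?_⟩) ?_
      · obtain ⟨a, -, rfl⟩ := Finset.mem_map.1 hw
        rw [hLv]
        by_cases hea : EssAt σ (F.toRel e) a
        · obtain rfl := hF e a i hea hi
          rw [← hiv] at hv1
          exact hv1
        · exact ha a hea
      · rw [hess]
        exact (isEssential_iff F σ e v).2 ⟨i, hi, hiv⟩
    rw [isStarCore_unique (starCore_spec _) hcore, hLv]
  · intro j
    induction j with
    | zero => simp [hD, coreChain, delChain]
    | succ j ih =>
      intro hj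
      obtain ⟨v, hv1, hv2, hv3⟩ := hpick j (by omega)
      have hsub : supported σ (D (j + 1))ᶜ F.toRel ⊆ supported σ (D j)ᶜ F.toRel :=
        supported_mono σ _ (Finset.compl_subset_compl.2 (hmono (Nat.le_succ j)))
      refine Disjoint.mono_right hsub ?_
      rw [hv3, Finset.disjoint_union_left]
      exact ⟨ih (by omega), by simpa using hv2⟩

variable {Υ : CSPModel k}

/-! ### The product measure on constraints with repeated variables -/

open scoped Classical in
/-- The total mass of the pairs of a Boolean function and a satisfying assignment of it. -/
def CSPModel.satMass (Υ : CSPModel k) : ℝ :=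
  ∑ φ, ∑ s : Fin k → ℤˣ, if φ s = true then Υ.p φ else 0

open scoped Classical in
/-- The law of a pair of a Boolean function and an assignment to its arguments, given that
the assignment is satisfying. -/
def CSPModel.patProb (Υ : CSPModel k) (φ : BoolFn k) (s : Fin k → ℤˣ) : ℝ :=
  (if φ s = true then Υ.p φ else 0) / Υ.satMass

/-- The law of a constraint that is obtained by choosing a Boolean function together with
the signs of its arguments first, and then independent uniformly random variables with these signs
(so that variables may be repeated). -/
def CSPModel.relWeight (Υ : CSPModel k) (σ : Fin n → ℤˣ) (c : RelConstraint k n) : ℝ :=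
  Υ.patProb c.1 (fun a => σ (c.2 a)) * ∏ a, (1 / ((signClass σ (σ (c.2 a))).card : ℝ))

lemma satMass_nonneg : 0 ≤ Υ.satMass :=
  Finset.sum_nonneg fun φ _ => Finset.sum_nonneg fun s _ => by
    split_ifs
    · exact Υ.p_nonneg φ
    · exact le_rfl

lemma satMass_pos (hsat : ∃ φ ∈ Υ.Φ, ∃ s : Fin k → ℤˣ, φ s = true) : 0 < Υ.satMass := by
  classical
  obtain ⟨φ, hφ, s, hs⟩ := hsat
  have hnn : ∀ φ' : BoolFn k, ∀ s', 0 ≤ (if φ' s' = true then Υ.p φ' else 0) := fun φ' s' => by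
    split_ifs
    · exact Υ.p_nonneg φ'
    · exact le_rfl
  have h1 : Υ.p φ ≤ ∑ s' : Fin k → ℤˣ, (if φ s' = true then Υ.p φ else 0) := by
    have := Finset.single_le_sum (f := fun s' => if φ s' = true then Υ.p φ else 0)
      (fun s' _ => hnn φ s') (Finset.mem_univ s)
    simpa [hs] using this
  have h2 := Finset.single_le_sum
    (f := fun φ' => ∑ s' : Fin k → ℤˣ, (if φ' s' = true then Υ.p φ' else 0))
    (fun φ' _ => Finset.sum_nonneg fun s' _ => hnn φ' s') (Finset.mem_univ φ)
  exact hφ.trans_le (h1.trans h2)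

lemma patProb_nonneg (φ : BoolFn k) (s : Fin k → ℤˣ) : 0 ≤ Υ.patProb φ s := by
  unfold CSPModel.patProb
  refine div_nonneg ?_ satMass_nonneg
  split_ifs
  · exact Υ.p_nonneg φ
  · exact le_rfl

lemma sum_patProb (h : 0 < Υ.satMass) : ∑ φ, ∑ s, Υ.patProb φ s = 1 := by
  unfold CSPModel.patProb
  simp_rw [← Finset.sum_div]
  exact div_self h.ne'

lemma mem_Φ_of_patProb_ne_zero {φ : BoolFn k} {s : Fin k → ℤˣ} (h : Υ.patProb φ s ≠ 0) :
    φ ∈ Υ.Φ := by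
  refine lt_of_le_of_ne (Υ.p_nonneg φ) fun h0 => h ?_
  simp [CSPModel.patProb, ← h0]

lemma patProb_neg (hsym : Υ.Symmetric) (φ : BoolFn k) (s : Fin k → ℤˣ) :
    Υ.patProb φ (-s) = Υ.patProb φ s := by
  unfold CSPModel.patProb
  by_cases hφ : φ ∈ Υ.Φ
  · rw [hsym φ hφ]
  · have : Υ.p φ = 0 := le_antisymm (not_lt.1 hφ) (Υ.p_nonneg φ)
    simp [this]

lemma flipAt_neg (s : Fin k → ℤˣ) (i : Fin k) : flipAt (-s) i = -flipAt s i := by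
  ext1 a
  by_cases h : a = i
  · subst h; simp [flipAt]
  · simp [flipAt, h]

lemma essPos_neg (hsym : Υ.Symmetric) {φ : BoolFn k} (hφ : φ ∈ Υ.Φ) (s : Fin k → ℤˣ) (i : Fin k) :
    EssPos φ (-s) i ↔ EssPos φ s i := by
  unfold EssPos
  rw [flipAt_neg, hsym φ hφ, hsym φ hφ]

lemma essPos_unique (hess : Υ.OneEssential) {φ : BoolFn k} (hφ : φ ∈ Υ.Φ) {s : Fin k → ℤˣ}
    {i j : Fin k} (hi : EssPos φ s i) (hj : EssPos φ s j) : i = j :=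
  hess φ hφ s hi.1 i j hi.2 hj.2

lemma relWeight_nonneg (σ : Fin n → ℤˣ) (c : RelConstraint k n) : 0 ≤ Υ.relWeight σ c :=
  mul_nonneg (patProb_nonneg _ _) (Finset.prod_nonneg fun _ _ => by positivity)

lemma mem_Φ_of_relWeight_ne_zero {σ : Fin n → ℤˣ} {c : RelConstraint k n}
    (h : Υ.relWeight σ c ≠ 0) : c.1 ∈ Υ.Φ :=
  mem_Φ_of_patProb_ne_zero (left_ne_zero_of_mul h)

lemma uniqueEss_of_mem_Φ (hess : Υ.OneEssential) (σ : Fin n → ℤˣ) {c : RelConstraint k n}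
    (h : c.1 ∈ Υ.Φ) : UniqueEss σ c := fun _ _ => essPos_unique hess h

/-- Summing over the signs of the variables first, the choices of the variables are independent. -/
lemma sum_sign_mul_prod (σ : Fin n → ℤˣ) (G : (Fin k → ℤˣ) → ℝ) (h : Fin k → Fin n → ℝ) :
    ∑ t : Fin k → Fin n, G (fun a => σ (t a)) * ∏ a, h a (t a) =
      ∑ s, G s * ∏ a, ∑ v ∈ signClass σ (s a), h a v := by
  have h1 : ∀ s : Fin k → ℤˣ, ∏ a, ∑ v ∈ signClass σ (s a), h a v =
      ∑ t : Fin k → Fin n with (fun a => σ (t a)) = s, ∏ a, h a (t a) := by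
    intro s
    rw [Finset.prod_univ_sum]
    refine Finset.sum_congr ?_ fun _ _ => rfl
    ext t
    simp [Fintype.mem_piFinset, funext_iff]
  simp_rw [h1, Finset.mul_sum]
  rw [← Finset.sum_fiberwise (s := Finset.univ) (g := fun t : Fin k → Fin n => fun a => σ (t a))]
  refine Finset.sum_congr rfl fun s _ => Finset.sum_congr rfl fun t ht => ?_
  rw [(Finset.mem_filter.1 ht).2]

lemma sum_relWeight_mul (σ : Fin n → ℤˣ) (hσ : ∀ s, 0 < (signClass σ s).card)
    (G : BoolFn k → (Fin k → ℤˣ) → ℝ) :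
    ∑ c, Υ.relWeight σ c * G c.1 (fun a => σ (c.2 a)) = ∑ φ, ∑ s, Υ.patProb φ s * G φ s := by
  rw [Fintype.sum_prod_type]
  refine Finset.sum_congr rfl fun φ _ => ?_
  have h := sum_sign_mul_prod σ (fun s => Υ.patProb φ s * G φ s)
    (fun _ v => 1 / ((signClass σ (σ v)).card : ℝ))
  have h1 : ∀ s : ℤˣ, ∑ v ∈ signClass σ s, 1 / ((signClass σ (σ v)).card : ℝ) = 1 := by
    intro s
    rw [Finset.sum_congr rfl (g := fun _ => 1 / ((signClass σ s).card : ℝ))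
      fun v hv => by rw [mem_signClass.1 hv]]
    have := (hσ s).ne'
    simp [this]
  simp only [h1, Finset.prod_const_one, mul_one] at h
  rw [← h]
  refine Finset.sum_congr rfl fun t _ => ?_
  simp only [CSPModel.relWeight]
  ring

lemma sum_relWeight (h : 0 < Υ.satMass) (σ : Fin n → ℤˣ) (hσ : ∀ s, 0 < (signClass σ s).card) :
    ∑ c, Υ.relWeight σ c = 1 := by
  have := sum_relWeight_mul (Υ := Υ) σ hσ fun _ _ => 1
  simpa [sum_patProb h] using this

open scoped Classical in
/-- The probability, under `relWeight`, of a constraint with an essential position. -/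
def CSPModel.essMass (Υ : CSPModel k) (σ : Fin n → ℤˣ) : ℝ :=
  ∑ c : RelConstraint k n, if HasEss σ c then Υ.relWeight σ c else 0

open scoped Classical in
/-- By symmetry, the essential vertex of a random constraint has either sign with
the same probability. -/
lemma sum_patProb_sign (hess : Υ.OneEssential) (hsym : Υ.Symmetric) (σ : Fin n → ℤˣ)
    (hσ : ∀ s, 0 < (signClass σ s).card) (s₀ : ℤˣ) :
    ∑ φ, ∑ i, ∑ s : Fin k → ℤˣ, Υ.patProb φ s * (if EssPos φ s i ∧ s i = s₀ then 1 else 0) =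
      Υ.essMass σ / 2 := by
  set S : ℤˣ → ℝ := fun s₀ => ∑ φ, ∑ i, ∑ s : Fin k → ℤˣ,
    Υ.patProb φ s * (if EssPos φ s i ∧ s i = s₀ then 1 else 0) with hS
  have hneg : ∀ s₀, S (-s₀) = S s₀ := by
    intro s₀
    refine Finset.sum_congr rfl fun φ _ => Finset.sum_congr rfl fun i _ => ?_
    refine Fintype.sum_equiv (Equiv.neg _) _ _ fun s => ?_
    simp only [Equiv.neg_apply]
    rw [patProb_neg hsym]
    by_cases h0 : Υ.patProb φ s = 0
    · simp [h0]
    · rw [essPos_neg hsym (mem_Φ_of_patProb_ne_zero h0)]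
      simp [neg_eq_iff_eq_neg]
  have hsum : S 1 + S (-1) = Υ.essMass σ := by
    have h1 := sum_relWeight_mul (Υ := Υ) σ hσ fun φ s => if ∃ i, EssPos φ s i then 1 else 0
    have h2 : Υ.essMass σ = ∑ c : RelConstraint k n, Υ.relWeight σ c *
        (if ∃ i, EssPos c.1 (fun a => σ (c.2 a)) i then 1 else 0) := by
      refine Finset.sum_congr rfl fun c _ => ?_
      by_cases hE : HasEss σ c
      · rw [if_pos hE, if_pos (show ∃ i, EssPos c.1 (fun a => σ (c.2 a)) i from hE), mul_one]
      · rw [if_neg hE, if_neg (show ¬ ∃ i, EssPos c.1 (fun a => σ (c.2 a)) i from hE), mul_zero]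
    rw [h2, h1]
    simp only [hS, ← Finset.sum_add_distrib, ← mul_add]
    refine Finset.sum_congr rfl fun φ _ => ?_
    rw [Finset.sum_comm]
    refine Finset.sum_congr rfl fun s _ => ?_
    rw [← Finset.mul_sum]
    by_cases h0 : Υ.patProb φ s = 0
    · simp [h0]
    congr 1
    by_cases hex : ∃ i, EssPos φ s i
    · obtain ⟨i, hi⟩ := hex
      rw [if_pos ⟨i, hi⟩, Finset.sum_eq_single i]
      · rcases Int.units_eq_one_or (s i) with h | h <;> simp [hi, h]
      · intro j _ hj
        have : ¬ EssPos φ s j := fun h =>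
          hj (essPos_unique hess (mem_Φ_of_patProb_ne_zero h0) h hi)
        simp [this]
      · simp
    · push Not at hex
      simp [hex]
  have h1 := hneg 1
  have h2 : S s₀ = S 1 := by
    rcases Int.units_eq_one_or s₀ with rfl | rfl
    · rfl
    · exact h1
  change S s₀ = _
  rw [h2]
  linarith

open scoped Classical in
/-- The probability that a random constraint supports the vertex `v`, by the signs of
its arguments. -/
lemma sum_relWeight_heads (hess : Υ.OneEssential) (σ : Fin n → ℤˣ) (A : Finset (Fin n))
    (v : Fin n) :
    (∑ c : RelConstraint k n, if v ∈ heads σ A c then Υ.relWeight σ c else 0) =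
      ∑ φ, ∑ i, ∑ s : Fin k → ℤˣ, Υ.patProb φ s * (if EssPos φ s i ∧ s i = σ v then 1 else 0) *
        (1 / ((signClass σ (σ v)).card : ℝ) *
          ∏ a ∈ Finset.univ.erase i,
            ((A ∩ signClass σ (s a)).card : ℝ) / (signClass σ (s a)).card) := by
  rw [Fintype.sum_prod_type]
  refine Finset.sum_congr rfl fun φ _ => ?_
  set h : Fin k → Fin k → Fin n → ℝ := fun i a u =>
    (if a = i then (if u = v then 1 else 0) else (if u ∈ A then 1 else 0)) *
      (1 / ((signClass σ (σ u)).card : ℝ)) with hh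
  have key : ∀ i, ∑ t : Fin k → Fin n, (Υ.patProb φ (fun a => σ (t a)) *
      (if EssPos φ (fun a => σ (t a)) i then 1 else 0)) * ∏ a, h i a (t a) =
      ∑ s : Fin k → ℤˣ, Υ.patProb φ s * (if EssPos φ s i ∧ s i = σ v then 1 else 0) *
        (1 / ((signClass σ (σ v)).card : ℝ) *
          ∏ a ∈ Finset.univ.erase i,
            ((A ∩ signClass σ (s a)).card : ℝ) / (signClass σ (s a)).card) := by
    intro i
    rw [sum_sign_mul_prod σ (fun s => Υ.patProb φ s * (if EssPos φ s i then 1 else 0)) (h i)]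
    refine Finset.sum_congr rfl fun s _ => ?_
    rw [← Finset.mul_prod_erase _ _ (Finset.mem_univ i)]
    have e1 : ∑ u ∈ signClass σ (s i), h i i u =
        if s i = σ v then 1 / ((signClass σ (σ v)).card : ℝ) else 0 := by
      simp only [hh, if_true, ite_mul, one_mul, zero_mul]
      rw [Finset.sum_ite_eq']
      simp [mem_signClass, eq_comm]
    have e2 : ∀ a ∈ Finset.univ.erase i, ∑ u ∈ signClass σ (s a), h i a u =
        ((A ∩ signClass σ (s a)).card : ℝ) / (signClass σ (s a)).card := by
      intro a ha
      simp only [hh, if_neg (Finset.ne_of_mem_erase ha)]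
      rw [Finset.sum_congr rfl (g := fun u => (if u ∈ A then 1 else 0) *
        (1 / ((signClass σ (s a)).card : ℝ))) fun u hu => by rw [mem_signClass.1 hu],
        ← Finset.sum_mul, Finset.sum_boole, Finset.filter_mem_eq_inter, Finset.inter_comm A]
      ring
    rw [e1, Finset.prod_congr rfl e2]
    by_cases hE : EssPos φ s i <;> by_cases hs : s i = σ v <;> simp [hE, hs]
  simp_rw [← key]
  rw [Finset.sum_comm]
  refine Finset.sum_congr rfl fun t _ => ?_
  by_cases h0 : Υ.patProb φ (fun a => σ (t a)) = 0
  · simp [CSPModel.relWeight, h0]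
  have huniq : ∀ i j, EssPos φ (fun a => σ (t a)) i → EssPos φ (fun a => σ (t a)) j → i = j :=
    fun i j => essPos_unique hess (mem_Φ_of_patProb_ne_zero h0)
  by_cases hex : ∃ i, EssPos φ (fun a => σ (t a)) i
  · obtain ⟨i, hi⟩ := hex
    rw [Finset.sum_eq_single i]
    · simp only [hi, if_true, mul_one, hh, Finset.prod_mul_distrib]
      have e3 : (∏ a, if a = i then (if t a = v then (1 : ℝ) else 0) else
          (if t a ∈ A then 1 else 0)) = if v ∈ heads σ A (φ, t) then 1 else 0 := by
        have e4 : ∀ a, (if a = i then (if t a = v then (1 : ℝ) else 0) else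
          (if t a ∈ A then 1 else 0)) =
            if (if a = i then t a = v else t a ∈ A) then 1 else 0 := by
          intro a; split_ifs <;> rfl
        simp_rw [e4]
        rw [Finset.prod_boole]
        congr 1
        simp only [Finset.mem_univ, forall_const, mem_heads, eq_iff_iff]
        constructor
        · intro ha
          refine ⟨i, hi, by simpa using ha i, fun a hna => ?_⟩
          have hai : a ≠ i := fun h => hna (h ▸ hi)
          simpa [hai] using ha a
        · rintro ⟨j, hj, hjv, hA⟩ a
          obtain rfl := huniq _ _ hi hj
          split_ifs with hai
          · exact hai ▸ hjv
          · exact hA a fun hea => hai (huniq _ _ hea hi)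
      rw [e3]
      simp only [CSPModel.relWeight]
      split_ifs <;> simp
    · intro j _ hj
      have : ¬ EssPos φ (fun a => σ (t a)) j := fun h => hj (huniq _ _ h hi)
      simp [this]
    · simp
  · have hnot : v ∉ heads σ A (φ, t) := fun hv => by
      obtain ⟨i, hi, -⟩ := mem_heads.1 hv
      exact hex ⟨i, hi⟩
    push Not at hex
    simp [hex, hnot]

open scoped Classical in
lemma sum_relWeight_heads_le (hess : Υ.OneEssential) (hsym : Υ.Symmetric) (σ : Fin n → ℤˣ)
    (hσ : ∀ s, 0 < (signClass σ s).card) (A : Finset (Fin n)) (v : Fin n) {y : ℝ}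
    (hy : ∀ s, ((A ∩ signClass σ s).card : ℝ) / (signClass σ s).card ≤ y) :
    (∑ c : RelConstraint k n, if v ∈ heads σ A c then Υ.relWeight σ c else 0) ≤
      y ^ (k - 1) / (2 * (signClass σ (σ v)).card) * Υ.essMass σ := by
  have e : y ^ (k - 1) / (2 * (signClass σ (σ v)).card) * Υ.essMass σ =
      (Υ.essMass σ / 2) * (1 / ((signClass σ (σ v)).card : ℝ) * y ^ (k - 1)) := by
    have : ((signClass σ (σ v)).card : ℝ) ≠ 0 := by exact_mod_cast (hσ _).ne'
    field_simp
  rw [sum_relWeight_heads hess, e, ← sum_patProb_sign hess hsym σ hσ (σ v)]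
  simp_rw [Finset.sum_mul]
  refine Finset.sum_le_sum fun φ _ => Finset.sum_le_sum fun i _ => Finset.sum_le_sum fun s _ => ?_
  refine mul_le_mul_of_nonneg_left (mul_le_mul_of_nonneg_left ?_ (by positivity)) ?_
  · calc _ ≤ ∏ _a ∈ Finset.univ.erase i, y :=
        Finset.prod_le_prod (fun _ _ => by positivity) fun a _ => hy (s a)
      _ = y ^ (k - 1) := by simp [Finset.card_erase_of_mem]
  · exact mul_nonneg (patProb_nonneg _ _) (by split_ifs <;> norm_num)

open scoped Classical in
lemma le_sum_relWeight_heads (hess : Υ.OneEssential) (hsym : Υ.Symmetric) (σ : Fin n → ℤˣ)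
    (hσ : ∀ s, 0 < (signClass σ s).card) (A : Finset (Fin n)) (v : Fin n) {y : ℝ} (hy0 : 0 ≤ y)
    (hy : ∀ s, y ≤ ((A ∩ signClass σ s).card : ℝ) / (signClass σ s).card) :
    y ^ (k - 1) / (2 * (signClass σ (σ v)).card) * Υ.essMass σ ≤
      ∑ c : RelConstraint k n, if v ∈ heads σ A c then Υ.relWeight σ c else 0 := by
  have e : y ^ (k - 1) / (2 * (signClass σ (σ v)).card) * Υ.essMass σ =
      (Υ.essMass σ / 2) * (1 / ((signClass σ (σ v)).card : ℝ) * y ^ (k - 1)) := by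
    have : ((signClass σ (σ v)).card : ℝ) ≠ 0 := by exact_mod_cast (hσ _).ne'
    field_simp
  rw [sum_relWeight_heads hess, e, ← sum_patProb_sign hess hsym σ hσ (σ v)]
  simp_rw [Finset.sum_mul]
  refine Finset.sum_le_sum fun φ _ => Finset.sum_le_sum fun i _ => Finset.sum_le_sum fun s _ => ?_
  refine mul_le_mul_of_nonneg_left (mul_le_mul_of_nonneg_left ?_ (by positivity)) ?_
  · calc y ^ (k - 1) = ∏ _a ∈ Finset.univ.erase i, y := by simp [Finset.card_erase_of_mem]
      _ ≤ _ := Finset.prod_le_prod (fun _ _ => hy0) fun a _ => hy (s a)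
  · exact mul_nonneg (patProb_nonneg _ _) (by split_ifs <;> norm_num)

/-! ### Exponential moments of the number of unsupported vertices -/

open scoped Classical in
/-- Exponential moment bound for the number of elements of `U` that are not covered by
independent random sets, restricted to the event that exactly `m` of the random elements are
distinguished (`ess`); only these cover something. If each distinguished element changes the exponent
from `θ` to `c θ`, then the total effect is the factor `c ^ m`. -/
lemma sum_exp_uncovered_le {X V : Type*} [Fintype X] [DecidableEq V] (w : X → ℝ)
    (hw : ∀ x, 0 ≤ w x) (hw1 : ∑ x, w x ≤ 1) (ess : X → Prop) (cov : X → Finset V)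
    (hcov : ∀ x, ¬ ess x → cov x = ∅) (T : Set ℝ) (c : ℝ) (hT : ∀ θ ∈ T, c * θ ∈ T)
    (V₀ : Finset V)
    (hstep : ∀ θ ∈ T, ∀ U ⊆ V₀, (∑ x, if ess x then w x * Real.exp (θ * (U \ cov x).card) else 0) ≤
      (∑ x, if ess x then w x else 0) * Real.exp (c * θ * U.card)) (M : ℕ) :
    ∀ m : ℕ, ∀ θ ∈ T, ∀ U ⊆ V₀,
      (∑ F : Fin M → X, if (Finset.univ.filter fun e => ess (F e)).card = m then
        (∏ e, w (F e)) * Real.exp (θ * (U \ Finset.univ.biUnion fun e => cov (F e)).card) else 0) ≤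
      Real.exp (c ^ m * θ * U.card) := by
  induction M with
  | zero =>
    intro m θ _ U _
    rcases Nat.eq_zero_or_pos m with rfl | hm
    · simp
    · rw [Fintype.sum_unique, if_neg (by simp; omega)]
      positivity
  | succ M ih =>
    intro m θ hθ U hU
    have hsplit : (∑ F : Fin (M + 1) → X, if (Finset.univ.filter fun e => ess (F e)).card = m then
        (∏ e, w (F e)) * Real.exp (θ * (U \ Finset.univ.biUnion fun e => cov (F e)).card) else 0) =
        ∑ x, w x * ∑ F : Fin M → X,
          if (Finset.univ.filter fun e => ess (F e)).card + (if ess x then 1 else 0) = m then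
            (∏ e, w (F e)) *
              Real.exp (θ * ((U \ cov x) \ Finset.univ.biUnion fun e => cov (F e)).card) else 0 := by
      rw [← (Fin.consEquiv fun _ => X).sum_comp, Fintype.sum_prod_type]
      refine Finset.sum_congr rfl fun x _ => ?_
      rw [Finset.mul_sum]
      refine Finset.sum_congr rfl fun F _ => ?_
      have e1 : (Finset.univ.filter fun e : Fin (M + 1) => ess (Fin.consEquiv (fun _ => X) (x, F) e)).card
          = (Finset.univ.filter fun e => ess (F e)).card + (if ess x then 1 else 0) := by
        rw [Finset.card_filter, Fin.sum_univ_succ, Finset.card_filter, add_comm]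
        simp [Fin.consEquiv]
      have e2 : (U \ Finset.univ.biUnion fun e : Fin (M + 1) =>
          cov (Fin.consEquiv (fun _ => X) (x, F) e)) =
          (U \ cov x) \ Finset.univ.biUnion fun e => cov (F e) := by
        ext v
        simp [Fin.forall_fin_succ, Fin.consEquiv]
        tauto
      rw [e1, e2]
      simp only [Fin.consEquiv, Equiv.coe_fn_mk, Fin.prod_univ_succ, Fin.cons_zero, Fin.cons_succ]
      split_ifs <;> ring
    rw [hsplit]
    have hone : ∑ x, (if ess x then w x else 0) + ∑ x, (if ess x then 0 else w x) ≤ 1 := by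
      rw [← Finset.sum_add_distrib]
      refine le_trans (le_of_eq (Finset.sum_congr rfl fun x _ => ?_)) hw1
      split_ifs <;> simp
    -- a distinguished first element reduces `m` by one, any other one has no effect
    have hbound : ∀ x, (w x * ∑ F : Fin M → X,
          if (Finset.univ.filter fun e => ess (F e)).card + (if ess x then 1 else 0) = m then
            (∏ e, w (F e)) *
              Real.exp (θ * ((U \ cov x) \ Finset.univ.biUnion fun e => cov (F e)).card) else 0) ≤
        (if ess x then (if m = 0 then 0 else
          w x * Real.exp (c ^ (m - 1) * θ * (U \ cov x).card)) else 0) +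
        (if ess x then 0 else w x) * Real.exp (c ^ m * θ * U.card) := by
      intro x
      by_cases hx : ess x
      · simp only [hx, if_true]
        rcases Nat.eq_zero_or_pos m with rfl | hm
        · simp
        · have := ih (m - 1) θ hθ (U \ cov x) (Finset.sdiff_subset.trans hU)
          have e3 : ∀ a : ℕ, a + 1 = m ↔ a = m - 1 := fun a => by omega
          simp only [e3, if_neg hm.ne', zero_mul, add_zero]
          exact mul_le_mul_of_nonneg_left this (hw x)
      · simp only [hx, if_false, add_zero, zero_add, hcov x hx, Finset.sdiff_empty]
        exact mul_le_mul_of_nonneg_left (ih m θ hθ U hU) (hw x)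
    refine (Finset.sum_le_sum fun x _ => hbound x).trans ?_
    rw [Finset.sum_add_distrib, ← Finset.sum_mul]
    have hess : (∑ x, if ess x then (if m = 0 then 0 else
        w x * Real.exp (c ^ (m - 1) * θ * (U \ cov x).card)) else 0) ≤
        (∑ x, if ess x then w x else 0) * Real.exp (c ^ m * θ * U.card) := by
      rcases Nat.eq_zero_or_pos m with rfl | hm
      · simp only [if_true, ite_self, Finset.sum_const_zero]
        exact mul_nonneg (Finset.sum_nonneg fun x _ => by split_ifs; exacts [hw x, le_rfl])
          (Real.exp_pos _).le
      · simp only [if_neg hm.ne']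
        have hmem : ∀ i : ℕ, c ^ i * θ ∈ T := by
          intro i
          induction i with
          | zero => simpa using hθ
          | succ i ih => rw [pow_succ', mul_assoc]; exact hT _ ih
        have := hstep _ (hmem (m - 1)) U hU
        rwa [← mul_assoc c, ← pow_succ', Nat.sub_add_cancel hm] at this
    nlinarith [Real.exp_pos (c ^ m * θ * U.card)]

open scoped Classical in
/-- The number of constraints with an essential position. -/
def essNum (σ : Fin n → ℤˣ) (F : Fin M → RelConstraint k n) : ℕ :=
  (Finset.univ.filter fun e => HasEss σ (F e)).card

open scoped Classical in
/-- The probability of an event for independent constraints with the law `relWeight`. -/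
def CSPModel.relPr (Υ : CSPModel k) (σ : Fin n → ℤˣ) (M : ℕ)
    (E : (Fin M → RelConstraint k n) → Prop) : ℝ :=
  ∑ F : Fin M → RelConstraint k n, if E F then ∏ e, Υ.relWeight σ (F e) else 0

lemma essMass_nonneg (σ : Fin n → ℤˣ) : 0 ≤ Υ.essMass σ :=
  Finset.sum_nonneg fun c _ => by split_ifs; exacts [relWeight_nonneg σ c, le_rfl]

open scoped Classical in
/-- One constraint with an essential position: its effect on the exponential moment of the number of
unsupported vertices. -/
lemma sum_relWeight_exp (hess : Υ.OneEssential) (σ : Fin n → ℤˣ) (A U : Finset (Fin n)) (θ : ℝ) :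
    (∑ c : RelConstraint k n, if HasEss σ c then
      Υ.relWeight σ c * Real.exp (θ * (U \ heads σ A c).card) else 0) =
    Real.exp (θ * U.card) * (Υ.essMass σ + (Real.exp (-θ) - 1) *
      ∑ v ∈ U, ∑ c : RelConstraint k n, if v ∈ heads σ A c then Υ.relWeight σ c else 0) := by
  rw [Finset.sum_comm, CSPModel.essMass, Finset.mul_sum, ← Finset.sum_add_distrib, Finset.mul_sum]
  refine Finset.sum_congr rfl fun c _ => ?_
  by_cases h0 : Υ.relWeight σ c = 0
  · simp [h0]
  have huniq : ∀ v ∈ heads σ A c, ∀ w ∈ heads σ A c, v = w := by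
    intro v hv w hw
    obtain ⟨i, hi, rfl, -⟩ := mem_heads.1 hv
    obtain ⟨j, hj, rfl, -⟩ := mem_heads.1 hw
    rw [uniqueEss_of_mem_Φ hess σ (mem_Φ_of_relWeight_ne_zero h0) i j hi hj]
  have hsum : (∑ v ∈ U, if v ∈ heads σ A c then Υ.relWeight σ c else 0) =
      (U ∩ heads σ A c).card * Υ.relWeight σ c := by
    rw [← Finset.sum_filter, Finset.sum_const, nsmul_eq_mul, Finset.filter_mem_eq_inter]
  rw [hsum]
  have hle : (U ∩ heads σ A c).card ≤ 1 := Finset.card_le_one.2 fun v hv w hw =>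
    huniq v (Finset.mem_inter.1 hv).2 w (Finset.mem_inter.1 hw).2
  have hcard := Finset.card_sdiff_add_card_inter U (heads σ A c)
  by_cases hE : HasEss σ c
  · simp only [hE, if_true]
    interval_cases hc : (U ∩ heads σ A c).card
    · rw [show (U \ heads σ A c).card = U.card by omega]
      simp; ring
    · have : ((U \ heads σ A c).card : ℝ) = U.card - 1 := by
        rw [← hcard]; push_cast; ring
      rw [this, show θ * ((U.card : ℝ) - 1) = θ * U.card + -θ by ring, Real.exp_add]
      simp; ring
  · have : heads σ A c = ∅ := by
      rw [Finset.eq_empty_iff_forall_notMem]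
      exact fun v hv => hE ((mem_heads.1 hv).imp fun i hi => hi.1)
    simp [hE, this]

open scoped Classical in
/-- The exponential Markov inequality for the number of unsupported vertices of sign `s`; it bounds
the upper tail for `θ ≥ 0` and the lower tail for `θ ≤ 0`. -/
lemma relPr_exp_le (hess : Υ.OneEssential) (hsat : 0 < Υ.satMass) (σ : Fin n → ℤˣ)
    (hσ : ∀ s, 0 < (signClass σ s).card) (A : Finset (Fin n)) (s : ℤˣ) (T : Set ℝ) (c : ℝ)
    (hT : ∀ θ ∈ T, c * θ ∈ T)
    (hstep : ∀ θ ∈ T, ∀ U ⊆ signClass σ s, Real.exp (θ * U.card) * (Υ.essMass σ +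
      (Real.exp (-θ) - 1) * ∑ v ∈ U, ∑ c : RelConstraint k n,
        if v ∈ heads σ A c then Υ.relWeight σ c else 0) ≤
      Υ.essMass σ * Real.exp (c * θ * U.card))
    {θ : ℝ} (hθ : θ ∈ T) (m : ℕ) {z : ℝ} (E : (Fin M → RelConstraint k n) → Prop)
    (hE : ∀ F, E F → essNum σ F = m ∧ θ * z ≤ θ * (signClass σ s \ supported σ A F).card) :
    Υ.relPr σ M E ≤ Real.exp (θ * (c ^ m * (signClass σ s).card - z)) := by
  have h := sum_exp_uncovered_le (Υ.relWeight σ) (relWeight_nonneg σ) (sum_relWeight hsat σ hσ).le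
    (HasEss σ) (heads σ A)
    (fun c hc => by
      rw [Finset.eq_empty_iff_forall_notMem]
      exact fun v hv => hc ((mem_heads.1 hv).imp fun i hi => hi.1))
    T c hT (signClass σ s)
    (fun θ hθ U hU => (sum_relWeight_exp hess σ A U θ).le.trans (hstep θ hθ U hU))
    M m θ hθ _ subset_rfl
  have hsupp : ∀ F : Fin M → RelConstraint k n,
      (Finset.univ.biUnion fun e => heads σ A (F e)) = supported σ A F := by
    intro F; ext v; simp [mem_supported]
  simp only [hsupp] at h
  have h1 : Real.exp (θ * (c ^ m * (signClass σ s).card - z)) =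
      Real.exp (-(θ * z)) * Real.exp (c ^ m * θ * (signClass σ s).card) := by
    rw [← Real.exp_add]; ring_nf
  rw [h1]
  refine le_trans ?_ (mul_le_mul_of_nonneg_left h (Real.exp_pos _).le)
  rw [Finset.mul_sum]
  refine Finset.sum_le_sum fun F _ => ?_
  have hprod : 0 ≤ ∏ e, Υ.relWeight σ (F e) := Finset.prod_nonneg fun e _ => relWeight_nonneg σ _
  by_cases hF : E F
  · obtain ⟨h2, h3⟩ := hE F hF
    rw [if_pos hF, if_pos (show (Finset.univ.filter fun e => HasEss σ (F e)).card = m from h2),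
      mul_left_comm, ← Real.exp_add]
    refine le_mul_of_one_le_right hprod (Real.one_le_exp ?_)
    linarith
  · rw [if_neg hF]
    split_ifs
    · positivity
    · simp

/-- Upper tail of the number of unsupported vertices of sign `s`. -/
lemma relPr_unsupported_ge (hess : Υ.OneEssential) (hsym : Υ.Symmetric) (hsat : 0 < Υ.satMass)
    (σ : Fin n → ℤˣ) (hσ : ∀ s, 0 < (signClass σ s).card) (A : Finset (Fin n)) {y : ℝ}
    (hy0 : 0 ≤ y) (hy1 : y ≤ 1)
    (hy : ∀ s, y ≤ ((A ∩ signClass σ s).card : ℝ) / (signClass σ s).card) (s : ℤˣ) {l : ℝ}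
    (hl0 : 0 ≤ l) (hl1 : l ≤ 1) (m : ℕ) {z : ℝ} (E : (Fin M → RelConstraint k n) → Prop)
    (hE : ∀ F, E F → essNum σ F = m ∧ z ≤ (signClass σ s \ supported σ A F).card) :
    Υ.relPr σ M E ≤ Real.exp (l *
      ((1 - (1 - l) * (y ^ (k - 1) / (2 * (signClass σ s).card))) ^ m *
        (signClass σ s).card - z)) := by
  set N : ℝ := ((signClass σ s).card : ℝ)
  have hN : 1 ≤ N := Nat.one_le_cast.2 (hσ s)
  set κ := y ^ (k - 1) / (2 * N) with hκ
  have hκ0 : 0 ≤ κ := by positivity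
  have hκ1 : κ ≤ 1 := by
    rw [hκ, div_le_one (by linarith)]
    linarith [pow_le_one₀ hy0 hy1 (n := k - 1)]
  have hκl : (1 - l) * κ ≤ 1 := mul_le_one₀ (by linarith) hκ0 hκ1
  have hκl0 : 0 ≤ (1 - l) * κ := mul_nonneg (by linarith) hκ0
  refine relPr_exp_le hess hsat σ hσ A s (Set.Icc 0 l) _ ?_ ?_ (Set.right_mem_Icc.2 hl0) m E ?_
  · exact fun θ hθ => ⟨mul_nonneg (by linarith) hθ.1,
      (mul_le_of_le_one_left hθ.1 (by linarith)).trans hθ.2⟩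
  · classical
    intro θ hθ U hU
    have h1 : (U.card : ℝ) * (κ * Υ.essMass σ) ≤ ∑ v ∈ U, ∑ c : RelConstraint k n,
        if v ∈ heads σ A c then Υ.relWeight σ c else 0 := by
      rw [← nsmul_eq_mul]
      refine Finset.card_nsmul_le_sum _ _ _ fun v hv => ?_
      have := le_sum_relWeight_heads hess hsym σ hσ A v hy0 hy
      rwa [mem_signClass.1 (hU hv)] at this
    have h2 : Real.exp (-θ) - 1 ≤ 0 := by
      have := Real.exp_le_one_iff.2 (neg_nonpos.2 hθ.1); linarith
    have h3 : (1 - l) * θ ≤ 1 - Real.exp (-θ) := by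
      have h4 := Real.abs_exp_sub_one_sub_id_le (x := -θ)
        (by rw [abs_neg, abs_of_nonneg hθ.1]; exact hθ.2.trans hl1)
      have h5 := (abs_le.1 h4).2
      nlinarith [hθ.1, hθ.2]
    have hP := essMass_nonneg (Υ := Υ) σ
    calc _ ≤ Real.exp (θ * U.card) * (Υ.essMass σ +
          (Real.exp (-θ) - 1) * ((U.card : ℝ) * (κ * Υ.essMass σ))) := by
          have := mul_le_mul_of_nonpos_left h1 h2
          gcongr Real.exp (θ * U.card) * (Υ.essMass σ + ?_)
      _ = Υ.essMass σ * (Real.exp (θ * U.card) * (-((1 - Real.exp (-θ)) * (κ * U.card)) + 1)) := by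
          ring
      _ ≤ Υ.essMass σ * (Real.exp (θ * U.card) *
          Real.exp (-((1 - Real.exp (-θ)) * (κ * U.card)))) := by
          gcongr
          exact Real.add_one_le_exp _
      _ ≤ _ := by
          rw [← Real.exp_add]
          gcongr
          have : (0 : ℝ) ≤ κ * U.card := by positivity
          nlinarith
  · intro F hF
    obtain ⟨h1, h2⟩ := hE F hF
    exact ⟨h1, mul_le_mul_of_nonneg_left h2 hl0⟩

/-- Lower tail of the number of unsupported vertices of sign `s`. -/
lemma relPr_unsupported_le (hess : Υ.OneEssential) (hsym : Υ.Symmetric) (hsat : 0 < Υ.satMass)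
    (σ : Fin n → ℤˣ) (hσ : ∀ s, 0 < (signClass σ s).card) (A : Finset (Fin n)) {y : ℝ}
    (hy0 : 0 ≤ y) (hy1 : y ≤ 1)
    (hy : ∀ s, ((A ∩ signClass σ s).card : ℝ) / (signClass σ s).card ≤ y) (s : ℤˣ) {l : ℝ}
    (hl0 : 0 ≤ l) (hl1 : l ≤ 1) (m : ℕ) {z : ℝ} (E : (Fin M → RelConstraint k n) → Prop)
    (hE : ∀ F, E F → essNum σ F = m ∧ ((signClass σ s \ supported σ A F).card : ℝ) ≤ z) :
    Υ.relPr σ M E ≤ Real.exp (-l *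
      ((1 - (1 + l) * (y ^ (k - 1) / (2 * (signClass σ s).card))) ^ m *
        (signClass σ s).card - z)) := by
  set N : ℝ := ((signClass σ s).card : ℝ)
  have hN : 1 ≤ N := Nat.one_le_cast.2 (hσ s)
  set κ := y ^ (k - 1) / (2 * N) with hκ
  have hκ0 : 0 ≤ κ := by positivity
  have hκ1 : κ ≤ 1 / 2 := by
    rw [hκ, div_le_iff₀ (by linarith)]
    linarith [pow_le_one₀ hy0 hy1 (n := k - 1)]
  have hκl : (1 + l) * κ ≤ 1 := by nlinarith
  have hκl0 : 0 ≤ (1 + l) * κ := mul_nonneg (by linarith) hκ0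
  refine relPr_exp_le hess hsat σ hσ A s (Set.Icc (-l) 0) _ ?_ ?_
    (Set.left_mem_Icc.2 (by linarith)) m E ?_
  · exact fun θ hθ => ⟨by nlinarith [hθ.1, hθ.2], mul_nonpos_of_nonneg_of_nonpos (by linarith) hθ.2⟩
  · classical
    intro θ hθ U hU
    have h1 : (∑ v ∈ U, ∑ c : RelConstraint k n,
        if v ∈ heads σ A c then Υ.relWeight σ c else 0) ≤ (U.card : ℝ) * (κ * Υ.essMass σ) := by
      rw [← nsmul_eq_mul]
      refine Finset.sum_le_card_nsmul _ _ _ fun v hv => ?_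
      have := sum_relWeight_heads_le hess hsym σ hσ A v hy
      rwa [mem_signClass.1 (hU hv)] at this
    have h2 : 0 ≤ Real.exp (-θ) - 1 := by
      have := Real.one_le_exp (neg_nonneg.2 hθ.2); linarith
    have h3 : Real.exp (-θ) - 1 ≤ (1 + l) * -θ := by
      have h4 := Real.abs_exp_sub_one_sub_id_le (x := -θ)
        (by rw [abs_neg, abs_of_nonpos hθ.2]; linarith [hθ.1])
      have h5 := (abs_le.1 h4).2
      nlinarith [hθ.1, hθ.2]
    have hP := essMass_nonneg (Υ := Υ) σ
    calc _ ≤ Real.exp (θ * U.card) * (Υ.essMass σ +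
          (Real.exp (-θ) - 1) * ((U.card : ℝ) * (κ * Υ.essMass σ))) := by
          have := mul_le_mul_of_nonneg_left h1 h2
          gcongr Real.exp (θ * U.card) * (Υ.essMass σ + ?_)
      _ = Υ.essMass σ * (Real.exp (θ * U.card) * (((Real.exp (-θ) - 1) * (κ * U.card)) + 1)) := by
          ring
      _ ≤ Υ.essMass σ * (Real.exp (θ * U.card) *
          Real.exp ((Real.exp (-θ) - 1) * (κ * U.card))) := by
          gcongr
          exact Real.add_one_le_exp _
      _ ≤ _ := by
          rw [← Real.exp_add]
          gcongr
          have : (0 : ℝ) ≤ κ * U.card := by positivity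
          nlinarith
  · intro F hF
    obtain ⟨h1, h2⟩ := hE F hF
    exact ⟨h1, mul_le_mul_of_nonpos_left h2 (by linarith)⟩

/-! ### Comparison of the planted model with the product measure -/

open scoped Classical in
/-- There are at least `m ^ k` ways to choose distinct elements from `k` sets of size at least
`m + k`. -/
lemma pow_le_card_injective {V : Type*} [Fintype V] (m k : ℕ) (S : Fin k → Finset V)
    (hS : ∀ a, m + k ≤ (S a).card) :
    m ^ k ≤ (Finset.univ.filter fun f : Fin k → V => Function.Injective f ∧ ∀ a, f a ∈ S a).card := by
  induction k with
  | zero => simp [Function.injective_of_subsingleton]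
  | succ k ih =>
    have hmap : ((S 0).sigma fun v => Finset.univ.filter fun f : Fin k → V =>
        Function.Injective f ∧ ∀ a, f a ∈ (S a.succ).erase v).card ≤
        (Finset.univ.filter fun f : Fin (k + 1) → V =>
          Function.Injective f ∧ ∀ a, f a ∈ S a).card := by
      refine Finset.card_le_card_of_injOn (fun x => Fin.cons x.1 x.2) ?_ ?_
      · rintro ⟨v, f⟩ hx
        simp only [Finset.coe_sigma, Set.mem_sigma_iff, Finset.mem_coe, Finset.mem_filter,
          Finset.mem_univ, true_and, Finset.mem_erase] at hx ⊢
        obtain ⟨hv, hf, hfS⟩ := hx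
        refine ⟨Fin.cons_injective_iff.2 ⟨?_, hf⟩, ?_⟩
        · rintro ⟨a, ha⟩
          exact (hfS a).1 ha
        · intro a
          refine Fin.cases hv (fun a => ?_) a
          exact (hfS a).2
      · rintro ⟨v, f⟩ - ⟨w, g⟩ - h
        obtain ⟨rfl, rfl⟩ := Fin.cons_injective2 h
        rfl
    refine le_trans ?_ hmap
    rw [Finset.card_sigma, pow_succ']
    have h0 : m ≤ (S 0).card := by have := hS 0; omega
    calc m * m ^ k ≤ (S 0).card * m ^ k := Nat.mul_le_mul_right _ h0
      _ = ∑ _v ∈ S 0, m ^ k := by simp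
      _ ≤ _ := Finset.sum_le_sum fun v _ => ih _ fun a => by
          have h1 := hS a.succ
          have h2 := Finset.pred_card_le_card_erase (s := S a.succ) (a := v)
          omega

open scoped Classical in
/-- The probability of a constraint, up to the constant factor from the choice of the variables, if it
is satisfied by `σ`, and `0` otherwise. -/
def CSPModel.satWeight (Υ : CSPModel k) (σ : Fin n → ℤˣ) (c : Constraint k n) : ℝ :=
  if Constraint.eval c σ = true then Υ.p c.1 else 0

/-- The law of a random constraint conditional on being satisfied by `σ`. -/
def CSPModel.condWeight (Υ : CSPModel k) (σ : Fin n → ℤˣ) (c : Constraint k n) : ℝ :=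
  Υ.satWeight σ c / ∑ c', Υ.satWeight σ c'

lemma satWeight_nonneg (σ : Fin n → ℤˣ) (c : Constraint k n) : 0 ≤ Υ.satWeight σ c := by
  unfold CSPModel.satWeight
  split_ifs
  exacts [Υ.p_nonneg _, le_rfl]

lemma condWeight_nonneg (σ : Fin n → ℤˣ) (c : Constraint k n) : 0 ≤ Υ.condWeight σ c :=
  div_nonneg (satWeight_nonneg σ c) (Finset.sum_nonneg fun c _ => satWeight_nonneg σ c)

open scoped Classical in
/-- In the planted model, the constraints are independent given the planted assignment. -/
lemma plantedProb_eq (hkn : k ≤ n) (F : CSP k n M) (σ : Fin n → ℤˣ) :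
    Υ.plantedProb F σ = (1 / 2 : ℝ) ^ n * ∏ e, Υ.condWeight σ (F e) := by
  set N : ℝ := (Fintype.card (Fin k ↪ Fin n) : ℝ) with hN
  have hN0 : N ≠ 0 := by
    have : 0 < Fintype.card (Fin k ↪ Fin n) := by
      rw [Fintype.card_embedding_eq, Fintype.card_fin, Fintype.card_fin]
      exact Nat.descFactorial_pos.2 hkn
    rw [hN]
    exact_mod_cast this.ne'
  have h1 : ∀ F : CSP k n M, (if F.Satisfies σ then Υ.randomProb F else 0) =
      ∏ e, Υ.satWeight σ (F e) * (1 / N) := by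
    intro F
    by_cases hF : F.Satisfies σ
    · rw [if_pos hF]
      refine Finset.prod_congr rfl fun e _ => ?_
      rw [CSPModel.satWeight, if_pos (hF e)]
    · rw [if_neg hF]
      unfold CSP.Satisfies at hF
      push Not at hF
      obtain ⟨e, he⟩ := hF
      refine (Finset.prod_eq_zero (Finset.mem_univ e) ?_).symm
      rw [CSPModel.satWeight, if_neg he, zero_mul]
  have h2 : (∑ F : CSP k n M, if F.Satisfies σ then Υ.randomProb F else 0) =
      ∏ _e : Fin M, (∑ c, Υ.satWeight σ c) * (1 / N) := by
    simp_rw [h1, Finset.sum_mul]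
    exact (Fintype.prod_sum fun (_ : Fin M) c => Υ.satWeight σ c * (1 / N)).symm
  unfold CSPModel.plantedProb
  congr 1
  have h3 : (if F.Satisfies σ then Υ.randomProb F /
      ∑ F' : CSP k n M, (if F'.Satisfies σ then Υ.randomProb F' else 0) else 0) =
      (if F.Satisfies σ then Υ.randomProb F else 0) /
        ∑ F' : CSP k n M, (if F'.Satisfies σ then Υ.randomProb F' else 0) := by
    split_ifs <;> simp
  rw [h3, h1, h2, ← Finset.prod_div_distrib]
  refine Finset.prod_congr rfl fun e _ => ?_
  rw [CSPModel.condWeight, mul_div_mul_right _ _ (one_div_ne_zero hN0)]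

open scoped Classical in
lemma pow_mul_satMass_le (σ : Fin n → ℤˣ) {m : ℕ} (hm : ∀ s, m + k ≤ (signClass σ s).card) :
    (m : ℝ) ^ k * Υ.satMass ≤ ∑ c : Constraint k n, Υ.satWeight σ c := by
  have h1 : ∀ s : Fin k → ℤˣ, (m : ℝ) ^ k ≤
      ((Finset.univ.filter fun t : Fin k ↪ Fin n => (fun a => σ (t a)) = s).card : ℝ) := by
    intro s
    have h2 := pow_le_card_injective m k (fun a => signClass σ (s a)) fun a => hm (s a)
    have h3 : (Finset.univ.filter fun f : Fin k → Fin n =>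
        Function.Injective f ∧ ∀ a, f a ∈ signClass σ (s a)).card ≤
        (Finset.univ.filter fun t : Fin k ↪ Fin n => (fun a => σ (t a)) = s).card := by
      refine Finset.card_le_card_of_surjOn (fun t a => t a) ?_
      intro f hf
      simp only [Finset.coe_filter, Finset.mem_univ, true_and, Set.mem_ofPred_eq,
        mem_signClass] at hf
      exact ⟨⟨f, hf.1⟩, by simpa [funext_iff] using hf.2, rfl⟩
    refine le_trans ?_ (Nat.cast_le.2 h3)
    rw [← Nat.cast_pow, Nat.cast_le]
    convert h2
  rw [Fintype.sum_prod_type, CSPModel.satMass, Finset.mul_sum]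
  refine Finset.sum_le_sum fun φ _ => ?_
  rw [Finset.mul_sum, ← Finset.sum_fiberwise (s := Finset.univ)
    (g := fun t : Fin k ↪ Fin n => fun a => σ (t a))]
  refine Finset.sum_le_sum fun s _ => ?_
  have h4 : ∑ t : Fin k ↪ Fin n with (fun a => σ (t a)) = s, Υ.satWeight σ (φ, t) =
      ((Finset.univ.filter fun t : Fin k ↪ Fin n => (fun a => σ (t a)) = s).card : ℝ) *
        (if φ s = true then Υ.p φ else 0) := by
    rw [← nsmul_eq_mul, ← Finset.sum_const]
    refine Finset.sum_congr rfl fun t ht => ?_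
    rw [← (Finset.mem_filter.1 ht).2]
    rfl
  rw [h4]
  refine mul_le_mul_of_nonneg_right (h1 s) ?_
  split_ifs
  exacts [Υ.p_nonneg _, le_rfl]

lemma sum_condWeight (hsat : 0 < Υ.satMass) (σ : Fin n → ℤˣ) {m : ℕ} (hm0 : 0 < m)
    (hm : ∀ s, m + k ≤ (signClass σ s).card) : ∑ c, Υ.condWeight σ c = 1 := by
  have h := pow_mul_satMass_le (Υ := Υ) σ hm
  have h1 : 0 < (m : ℝ) ^ k * Υ.satMass := by positivity
  unfold CSPModel.condWeight
  rw [← Finset.sum_div]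
  exact div_self (h1.trans_le h).ne'

/-- For an assignment that is nearly balanced, the ratio of the conditional law of a constraint to
the law `relWeight` is close to one. -/
lemma condWeight_le (hsat : 0 < Υ.satMass) (σ : Fin n → ℤˣ) {m : ℕ} (hm0 : 0 < m)
    (hm : ∀ s, m + k ≤ (signClass σ s).card) {B : ℝ} (hB : ∀ s, ((signClass σ s).card : ℝ) ≤ B)
    (c : Constraint k n) :
    Υ.condWeight σ c ≤ (B / m) ^ k * Υ.relWeight σ (c.1, fun a => c.2 a) := by
  have hmk : (0 : ℝ) < (m : ℝ) ^ k := by positivity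
  have h0 := satWeight_nonneg (Υ := Υ) σ c
  have hpos : ∀ s, (0 : ℝ) < (signClass σ s).card := fun s => by
    have := hm s
    exact_mod_cast (by omega : 0 < (signClass σ s).card)
  have hB0 : 0 < B := (hpos 1).trans_le (hB 1)
  have h1 : Υ.condWeight σ c ≤ Υ.satWeight σ c / ((m : ℝ) ^ k * Υ.satMass) :=
    div_le_div_of_nonneg_left h0 (by positivity) (pow_mul_satMass_le σ hm)
  have h2 : (1 / B) ^ k ≤ ∏ a, (1 / ((signClass σ (σ (c.2 a))).card : ℝ)) := by
    calc (1 / B) ^ k = ∏ _a : Fin k, 1 / B := by simp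
      _ ≤ _ := Finset.prod_le_prod (fun _ _ => by positivity) fun a _ =>
          one_div_le_one_div_of_le (hpos _) (hB _)
  have h3 : Υ.relWeight σ (c.1, fun a => c.2 a) = Υ.satWeight σ c / Υ.satMass *
      ∏ a, (1 / ((signClass σ (σ (c.2 a))).card : ℝ)) := rfl
  rw [h3]
  calc _ ≤ _ := h1
    _ = (B / m) ^ k * (Υ.satWeight σ c / Υ.satMass * (1 / B) ^ k) := by
        rw [div_pow, div_pow, one_pow]
        field_simp
    _ ≤ _ := by gcongr

open scoped Classical in
/-- The probability of an event in the planted model given the planted assignment. -/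
def CSPModel.condPr (Υ : CSPModel k) (σ : Fin n → ℤˣ) (M : ℕ) (E : CSP k n M → Prop) : ℝ :=
  ∑ F : CSP k n M, if E F then ∏ e, Υ.condWeight σ (F e) else 0

lemma toRel_injective : Function.Injective (CSP.toRel : CSP k n M → Fin M → RelConstraint k n) := by
  intro F G h
  ext1 e
  have := congrFun h e
  simp only [CSP.toRel, Prod.mk.injEq] at this
  exact Prod.ext this.1 (DFunLike.coe_injective this.2)

lemma relWeight_relabelTails (σ : Fin n → ℤˣ) (F : Fin M → RelConstraint k n) (e : Fin M) :
    Υ.relWeight σ (relabelTails σ F e) = Υ.relWeight σ (F e) := by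
  unfold CSPModel.relWeight
  simp only [fst_relabelTails, sign_relabelTails]

/-- An event of the planted model is bounded by the corresponding event for independent constraints
after the relabelling along the deletion process. -/
lemma condPr_le_relPr (hsat : 0 < Υ.satMass) (σ : Fin n → ℤˣ) {m : ℕ} (hm0 : 0 < m)
    (hm : ∀ s, m + k ≤ (signClass σ s).card) {B : ℝ} (hB : ∀ s, ((signClass σ s).card : ℝ) ≤ B)
    (E : CSP k n M → Prop) (E' : (Fin M → RelConstraint k n) → Prop)
    (hE : ∀ F : CSP k n M, (∀ e, (F e).1 ∈ Υ.Φ) → E F → E' (relabelTails σ F.toRel)) :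
    Υ.condPr σ M E ≤ ((B / m) ^ k) ^ M * Υ.relPr σ M E' := by
  classical
  have h1 : ∀ F : CSP k n M, (if E F then ∏ e, Υ.condWeight σ (F e) else 0) ≤
      ((B / m) ^ k) ^ M * (if E' (relabelTails σ F.toRel) then
        ∏ e, Υ.relWeight σ (relabelTails σ F.toRel e) else 0) := by
    intro F
    have hR : 0 ≤ (B / m) ^ k := by
      have := (Nat.cast_nonneg (α := ℝ) _).trans (hB 1)
      positivity
    simp only [relWeight_relabelTails]
    have hprod : 0 ≤ ∏ e, Υ.relWeight σ (F.toRel e) :=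
      Finset.prod_nonneg fun e _ => relWeight_nonneg σ _
    have hnn : 0 ≤ ((B / m) ^ k) ^ M * (if E' (relabelTails σ F.toRel) then
        ∏ e, Υ.relWeight σ (F.toRel e) else 0) := by
      split_ifs
      · positivity
      · simp
    by_cases hF : E F
    · by_cases hΦ : ∀ e, (F e).1 ∈ Υ.Φ
      · rw [if_pos hF, if_pos (hE F hΦ hF)]
        calc ∏ e, Υ.condWeight σ (F e) ≤ ∏ e, (B / m) ^ k * Υ.relWeight σ (F.toRel e) :=
              Finset.prod_le_prod (fun e _ => condWeight_nonneg σ _)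
                fun e _ => condWeight_le hsat σ hm0 hm hB (F e)
          _ = _ := by simp [Finset.prod_mul_distrib]
      · push Not at hΦ
        obtain ⟨e, he⟩ := hΦ
        have h0 : Υ.p (F e).1 = 0 := le_antisymm (not_lt.1 he) (Υ.p_nonneg _)
        rw [if_pos hF, Finset.prod_eq_zero (Finset.mem_univ e)]
        · exact hnn
        · simp [CSPModel.condWeight, CSPModel.satWeight, h0]
    · rw [if_neg hF]
      exact hnn
  refine (Finset.sum_le_sum fun F _ => h1 F).trans ?_
  rw [← Finset.mul_sum]
  have hR : 0 ≤ ((B / m) ^ k) ^ M := by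
    have := (Nat.cast_nonneg (α := ℝ) _).trans (hB 1)
    positivity
  refine mul_le_mul_of_nonneg_left ?_ hR
  -- the relabelled instances are distinct, so that their weights can be summed over all instances
  have hinj : Function.Injective fun F : CSP k n M => relabelTails σ F.toRel :=
    (relabelTails_injective σ).comp toRel_injective
  rw [← Finset.sum_image (g := fun F : CSP k n M => relabelTails σ F.toRel)
    (f := fun G => if E' G then ∏ e, Υ.relWeight σ (G e) else 0) fun _ _ _ _ h => hinj h]
  refine Finset.sum_le_sum_of_subset_of_nonneg (Finset.subset_univ _) fun G _ _ => ?_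
  split_ifs
  · exact Finset.prod_nonneg fun e _ => relWeight_nonneg σ _
  · exact le_rfl

/-- The union bound. -/
lemma relPr_exists_le (σ : Fin n → ℤˣ) {I : Type*} [Fintype I]
    (E : I → (Fin M → RelConstraint k n) → Prop) {b : ℝ} (hb : ∀ i, Υ.relPr σ M (E i) ≤ b) :
    Υ.relPr σ M (fun F => ∃ i, E i F) ≤ Fintype.card I * b := by
  classical
  have h1 : Υ.relPr σ M (fun F => ∃ i, E i F) ≤ ∑ i, Υ.relPr σ M (E i) := by
    unfold CSPModel.relPr
    rw [Finset.sum_comm]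
    refine Finset.sum_le_sum fun F _ => ?_
    have hprod : 0 ≤ ∏ e, Υ.relWeight σ (F e) :=
      Finset.prod_nonneg fun e _ => relWeight_nonneg σ _
    have hnn : ∀ i, 0 ≤ if E i F then ∏ e, Υ.relWeight σ (F e) else 0 := fun i => by
      split_ifs
      exacts [hprod, le_rfl]
    split_ifs with h
    · obtain ⟨i, hi⟩ := h
      have := Finset.single_le_sum (fun i _ => hnn i) (Finset.mem_univ i)
      rwa [if_pos hi] at this
    · exact Finset.sum_nonneg fun i _ => hnn i
  refine h1.trans ((Finset.sum_le_sum fun i _ => hb i).trans ?_)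
  simp

lemma condPr_eq_one_sub (hsat : 0 < Υ.satMass) (σ : Fin n → ℤˣ) {m : ℕ} (hm0 : 0 < m)
    (hm : ∀ s, m + k ≤ (signClass σ s).card) (E : CSP k n M → Prop) :
    Υ.condPr σ M E = 1 - Υ.condPr σ M (fun F => ¬ E F) := by
  classical
  have h1 : ∑ F : CSP k n M, ∏ e, Υ.condWeight σ (F e) = 1 := by
    rw [← Fintype.prod_sum fun (_ : Fin M) c => Υ.condWeight σ c]
    simp [sum_condWeight hsat σ hm0 hm]
  rw [← h1, eq_sub_iff_add_eq, CSPModel.condPr, CSPModel.condPr, ← Finset.sum_add_distrib]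
  refine Finset.sum_congr rfl fun F _ => ?_
  split_ifs <;> simp

lemma plantedPr_eq (hkn : k ≤ n) (E : CSP k n M → (Fin n → ℤˣ) → Prop) :
    Υ.plantedPr n M E = ∑ σ, (1 / 2 : ℝ) ^ n * Υ.condPr σ M (fun F => E F σ) := by
  classical
  unfold CSPModel.plantedPr CSPModel.condPr
  refine Finset.sum_congr rfl fun σ _ => ?_
  rw [Finset.mul_sum]
  refine Finset.sum_congr rfl fun F _ => ?_
  rw [plantedProb_eq hkn]
  split_ifs <;> simp

lemma condPr_nonneg (σ : Fin n → ℤˣ) (E : CSP k n M → Prop) : 0 ≤ Υ.condPr σ M E :=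
  Finset.sum_nonneg fun F _ => by
    split_ifs
    · exact Finset.prod_nonneg fun e _ => condWeight_nonneg σ _
    · exact le_rfl

/-! ### Positivity of the rates of decay -/

/-- If every `y` in `[y₀, 1]` is mapped to a smaller value, then the exponents of the lower tail bound
are bounded away from zero for these `y`. -/
lemma exists_gap_upper {k : ℕ} {α y₀ : ℝ} (hα : 0 ≤ α) (hy₀ : 0 < y₀)
    (h : ∀ y, y₀ ≤ y → y ≤ 1 → 1 - Real.exp (-(α * y ^ (k - 1))) < y) :
    ∃ l > 0, l ≤ 1 ∧ ∃ c > 0, ∃ N₀ : ℝ, ∀ N : ℝ, N₀ ≤ N → ∀ y, y₀ ≤ y → y ≤ 1 → ∀ m : ℕ,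
      (m : ℝ) ≤ (α + l) * (2 * N) →
        c ≤ (1 - (1 + l) * (y ^ (k - 1) / (2 * N))) ^ m - (1 - y) := by
  obtain ⟨c, hc0, hc⟩ : ∃ c > 0, ∀ y, y₀ ≤ y → y ≤ 1 →
      2 * c ≤ Real.exp (-(α * y ^ (k - 1))) - (1 - y) := by
    rcases (Set.Icc y₀ 1).eq_empty_or_nonempty with he | hne
    · exact ⟨1, one_pos, fun y h1 h2 => absurd (he ▸ ⟨h1, h2⟩ : y ∈ (∅ : Set ℝ)) (by simp)⟩
    · obtain ⟨z, hz, hmin⟩ := isCompact_Icc.exists_isMinOn hne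
        (f := fun y => Real.exp (-(α * y ^ (k - 1))) - (1 - y)) (by fun_prop)
      refine ⟨(Real.exp (-(α * z ^ (k - 1))) - (1 - z)) / 2, ?_, fun y h1 h2 => ?_⟩
      · linarith [h z hz.1 hz.2]
      · have := hmin ⟨h1, h2⟩
        simp only [Set.mem_ofPred_eq] at this
        linarith
  obtain ⟨l, hl0, hl1, hl⟩ : ∃ l > 0, l ≤ 1 ∧ (1 + l) * ((1 + l) * (α + l)) ≤ α + c := by
    have hcont : ContinuousAt (fun l : ℝ => (1 + l) * ((1 + l) * (α + l))) 0 := by fun_prop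
    have h1 : ∀ᶠ l in 𝓝[>] (0 : ℝ), (1 + l) * ((1 + l) * (α + l)) < α + c :=
      (hcont.tendsto.mono_left nhdsWithin_le_nhds).eventually_lt_const (by simp; linarith)
    obtain ⟨l, hl, hl'⟩ := (h1.and (Ioc_mem_nhdsGT one_pos)).exists
    exact ⟨l, hl'.1, hl'.2, hl.le⟩
  refine ⟨l, hl0, hl1, c, hc0, max 1 (2 / l), fun N hN y hy0 hy1 m hm => ?_⟩
  have hN1 : 1 ≤ N := (le_max_left _ _).trans hN
  have hNl : 2 / l ≤ N := (le_max_right _ _).trans hN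
  have hNl' : 2 ≤ N * l := by rwa [div_le_iff₀ hl0] at hNl
  have hypos : 0 < y := hy₀.trans_le hy0
  have hyk1 : y ^ (k - 1) ≤ 1 := pow_le_one₀ hypos.le hy1
  have hyk0 : 0 < y ^ (k - 1) := pow_pos hypos _
  set Y := y ^ (k - 1)
  set x := (1 + l) * (Y / (2 * N)) with hx
  have hx0 : 0 < x := by positivity
  have hxl : x ≤ l / 2 := by
    have e1 : x = (1 + l) * Y / (2 * N) := by rw [hx]; ring
    rw [e1, div_le_iff₀ (by linarith)]
    nlinarith
  have hx1 : 0 < 1 - x := by linarith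
  -- the reverse of `1 - x ≤ exp (-x)`, up to a factor in the exponent
  have hexp : Real.exp (-((1 + l) * x)) ≤ 1 - x := by
    have e1 := Real.one_sub_inv_le_log_of_pos hx1
    have e2 : -((1 + l) * x) ≤ 1 - (1 - x)⁻¹ := by
      have e3 : 1 - (1 - x)⁻¹ = -(x / (1 - x)) := by field_simp; ring
      rw [e3, neg_le_neg_iff, div_le_iff₀ hx1]
      nlinarith [mul_pos hx0 hl0]
    rw [← Real.le_log_iff_exp_le hx1]
    linarith
  have hpow : Real.exp (-(α * Y) - c) ≤ (1 - x) ^ m := by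
    calc Real.exp (-(α * Y) - c) ≤ Real.exp (-((1 + l) * x)) ^ m := by
          rw [← Real.exp_nat_mul, Real.exp_le_exp]
          have e1 : x * m ≤ (1 + l) * Y * (α + l) := by
            have e2 : x * ((α + l) * (2 * N)) = (1 + l) * Y * (α + l) := by
              rw [hx]; field_simp
            rw [← e2]
            exact mul_le_mul_of_nonneg_left hm hx0.le
          have e3 : (1 + l) * (x * m) ≤ (1 + l) * ((1 + l) * Y * (α + l)) :=
            mul_le_mul_of_nonneg_left e1 (by linarith)
          have e4 : (1 + l) * ((1 + l) * Y * (α + l)) ≤ (α + c) * Y := by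
            have := mul_le_mul_of_nonneg_right hl hyk0.le
            linarith
          nlinarith
      _ ≤ (1 - x) ^ m := pow_le_pow_left₀ (Real.exp_pos _).le hexp _
  have h1 := hc y hy0 hy1
  have h2 : Real.exp (-(α * Y)) - c ≤ Real.exp (-(α * Y) - c) := by
    have e1 : Real.exp (-(α * Y)) ≤ 1 := Real.exp_le_one_iff.2 (by
      have := mul_nonneg hα hyk0.le
      linarith)
    have e2 := Real.add_one_le_exp (-c)
    rw [sub_eq_add_neg (-(α * Y)), Real.exp_add]
    nlinarith [Real.exp_pos (-(α * Y))]
  linarith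

/-- If `y₀` is mapped to a larger value, then the exponent of the upper tail bound is positive for
densities slightly below `y₀`. -/
lemma exists_gap_lower {k : ℕ} {α y₀ : ℝ} (hy₀ : 0 < y₀)
    (h : y₀ < 1 - Real.exp (-(α * y₀ ^ (k - 1)))) :
    ∃ l > 0, l ≤ 1 ∧ l < y₀ ∧ ∃ c > 0, ∀ N : ℝ, 1 ≤ N → ∀ m : ℕ, (α - l) * (2 * N) ≤ m →
      (1 - (1 - l) * ((y₀ - l) ^ (k - 1) / (2 * N))) ^ m ≤ 1 - y₀ - c := by
  have hcont : ContinuousAt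
      (fun l : ℝ => Real.exp (-((1 - l) * (y₀ - l) ^ (k - 1) * (α - l)))) 0 := by fun_prop
  set c := (1 - Real.exp (-(α * y₀ ^ (k - 1))) - y₀) / 2 with hc
  have hc0 : 0 < c := by linarith
  have h1 : ∀ᶠ l in 𝓝[>] (0 : ℝ),
      Real.exp (-((1 - l) * (y₀ - l) ^ (k - 1) * (α - l))) < 1 - y₀ - c := by
    refine (hcont.tendsto.mono_left nhdsWithin_le_nhds).eventually_lt_const ?_
    simp only [sub_zero, one_mul]
    rw [mul_comm (y₀ ^ (k - 1))]
    linarith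
  obtain ⟨l, hl, hl'⟩ := (h1.and (Ioo_mem_nhdsGT (lt_min one_pos hy₀))).exists
  have hl1 : l < 1 := hl'.2.trans_le (min_le_left _ _)
  have hly : l < y₀ := hl'.2.trans_le (min_le_right _ _)
  refine ⟨l, hl'.1, hl1.le, hly, c, hc0, fun N hN m hm => ?_⟩
  set Y := (y₀ - l) ^ (k - 1) with hY
  have hY0 : 0 ≤ Y := pow_nonneg (by linarith) _
  have hy1 : y₀ ≤ 1 := by linarith [Real.exp_pos (-(α * y₀ ^ (k - 1)))]
  have hY1 : Y ≤ 1 := pow_le_one₀ (by linarith) (by linarith [hl'.1])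
  set x := (1 - l) * (Y / (2 * N)) with hx
  have hx0 : 0 ≤ x := mul_nonneg (by linarith) (by positivity)
  have hx1 : x ≤ 1 := by
    have e1 : Y / (2 * N) ≤ 1 := by rw [div_le_one (by linarith)]; linarith
    exact mul_le_one₀ (by linarith [hl'.1]) (by positivity) e1
  calc (1 - x) ^ m ≤ Real.exp (-x) ^ m :=
        pow_le_pow_left₀ (by linarith) (Real.one_sub_le_exp_neg x) _
    _ ≤ Real.exp (-((1 - l) * Y * (α - l))) := by
        rw [← Real.exp_nat_mul, Real.exp_le_exp]
        have e2 : x * ((α - l) * (2 * N)) = (1 - l) * Y * (α - l) := by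
          rw [hx]; field_simp
        have := mul_le_mul_of_nonneg_left hm hx0
        rw [e2] at this
        linarith
    _ ≤ _ := hl.le

/-! ### Large and small *-cores in terms of supported vertices -/

lemma card_compl_inter_add_signCount (σ : Fin n → ℤˣ) (D : Finset (Fin n)) (s : ℤˣ) :
    (Dᶜ ∩ signClass σ s).card + signCount σ D s = (signClass σ s).card := by
  have h := Finset.card_inter_add_card_sdiff (signClass σ s) D
  have h1 : signClass σ s \ D = Dᶜ ∩ signClass σ s := by ext; simp; tauto
  have h2 : signClass σ s ∩ D = D ∩ signClass σ s := Finset.inter_comm _ _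
  rw [h1, h2] at h
  unfold signCount
  omega

lemma essNum_relabelTails (σ : Fin n → ℤˣ) (F : CSP k n M) :
    essNum σ (relabelTails σ F.toRel) = (Gam F σ).edges.card := by
  classical
  unfold essNum
  congr 1
  ext e
  rw [gam_edges]
  simp [HasEss]

lemma card_eq_sum_inter_signClass (σ : Fin n → ℤˣ) (S : Finset (Fin n)) :
    (S.card : ℝ) = ∑ s, ((S ∩ signClass σ s).card : ℝ) := by
  have h := Finset.card_eq_sum_card_fiberwise (f := σ) (s := S) (t := Finset.univ)
    (fun _ _ => Finset.mem_coe.2 (Finset.mem_univ _))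
  rw [h]
  push_cast
  refine Finset.sum_congr rfl fun s _ => ?_
  congr 2
  ext v
  simp

/-- The event, for the relabelled instance, that there are `m` hyperedges, and at least `n_s - J s`
vertices of sign `s` are supported by the vertices other than the first `J s'` ones of each sign
`s'`. -/
def SupportedEvent (σ : Fin n → ℤˣ) (m : ℕ) (J : ℤˣ → ℕ) (s : ℤˣ)
    (F : Fin M → RelConstraint k n) : Prop :=
  essNum σ F = m ∧
    ((signClass σ s \ supported σ (laterVerts σ J) F).card : ℝ) ≤ J s

/-- The event, for the relabelled instance, that there are `m` hyperedges, and at least `J s`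
vertices of sign `s` are not supported by the vertices other than the first `J s'` ones of each sign
`s'`. -/
def UnsupportedEvent (σ : Fin n → ℤˣ) (m : ℕ) (J : ℤˣ → ℕ) (s : ℤˣ)
    (F : Fin M → RelConstraint k n) : Prop :=
  essNum σ F = m ∧
    (J s : ℝ) ≤ (signClass σ s \ supported σ (laterVerts σ J) F).card

/-- If the *-core is large, then for some sign `s` its density in the class of this sign is large and
at least the density in the other class, and all these vertices are supported. -/
lemma exists_supportedEvent (hess : Υ.OneEssential) (F : CSP k n M) (hF : ∀ e, (F e).1 ∈ Υ.Φ)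
    (σ : Fin n → ℤˣ) (hσ : ∀ s, 0 < (signClass σ s).card) {y : ℝ}
    (hy : y * n < (Gam F σ).starCore.verts.card) :
    ∃ (J : ℤˣ → ℕ) (s : ℤˣ), (∀ s', J s' ≤ (signClass σ s').card) ∧
      (J s : ℝ) ≤ (1 - y) * (signClass σ s).card ∧
      (∀ s', (J s : ℝ) / (signClass σ s).card ≤ J s' / (signClass σ s').card) ∧
      SupportedEvent σ (Gam F σ).edges.card J s (relabelTails σ F.toRel) := by
  obtain ⟨N, hN1, hN2, -⟩ := exists_starCore_eq F σ fun e => uniqueEss_of_mem_Φ hess σ (hF e)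
  set D := coreChain σ F.toRel N with hD
  have hcnt := card_compl_inter_add_signCount σ D
  have hpos : ∀ s, (0 : ℝ) < (signClass σ s).card := fun s => by exact_mod_cast hσ s
  obtain ⟨s, -, hs⟩ := Finset.exists_min_image Finset.univ
    (fun s => (signCount σ D s : ℝ) / (signClass σ s).card) ⟨1, Finset.mem_univ _⟩
  refine ⟨signCount σ D, s, fun s' => by have := hcnt s'; omega, ?_,
    fun s' => hs s' (Finset.mem_univ _), essNum_relabelTails σ F, ?_⟩
  · by_contra hcon
    push Not at hcon
    have h1 : ∀ s', ((Dᶜ ∩ signClass σ s').card : ℝ) ≤ y * (signClass σ s').card := by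
      intro s'
      have h2 := hs s' (Finset.mem_univ _)
      have h3 : 1 - y < (signCount σ D s : ℝ) / (signClass σ s).card := by
        rwa [lt_div_iff₀ (hpos s)]
      have h4 := h3.trans_le h2
      rw [lt_div_iff₀ (hpos s')] at h4
      have h5 : ((Dᶜ ∩ signClass σ s').card : ℝ) + signCount σ D s' = (signClass σ s').card := by
        exact_mod_cast hcnt s'
      linarith
    have h6 := card_eq_sum_inter_signClass σ (Dᶜ)
    have h7 := card_eq_sum_inter_signClass σ Finset.univ
    simp only [Finset.univ_inter, Finset.card_univ, Fintype.card_fin] at h7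
    rw [hN1, h6, h7, Finset.mul_sum] at hy
    exact hy.not_ge (Finset.sum_le_sum fun s' _ => h1 s')
  · rw [hD, supported_relabelTails]
    have h8 : signClass σ s \ supported σ Dᶜ F.toRel ⊆ D ∩ signClass σ s := by
      intro v hv
      rw [Finset.mem_sdiff] at hv
      rw [Finset.mem_inter]
      refine ⟨?_, hv.1⟩
      by_contra hvD
      exact hv.2 (hN2 (Finset.mem_compl.2 hvD))
    exact_mod_cast Finset.card_le_card h8

/-- If the *-core is small, then at the first time when the fraction of the deleted vertices
in one of the classes reaches `1 - y`, none of the deleted vertices is supported. -/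
lemma exists_unsupportedEvent (hess : Υ.OneEssential) (F : CSP k n M) (hF : ∀ e, (F e).1 ∈ Υ.Φ)
    (σ : Fin n → ℤˣ) (hσ : ∀ s, 0 < (signClass σ s).card) {y : ℝ} (hy1 : y < 1)
    (hy : ((Gam F σ).starCore.verts.card : ℝ) < y * n) :
    ∃ (J : ℤˣ → ℕ) (s : ℤˣ), (∀ s', J s' ≤ (signClass σ s').card) ∧
      (1 - y) * (signClass σ s).card ≤ J s ∧
      (∀ s', (J s' : ℝ) ≤ (1 - y) * (signClass σ s').card + 1) ∧
      UnsupportedEvent σ (Gam F σ).edges.card J s (relabelTails σ F.toRel) := by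
  classical
  obtain ⟨N, hN1, -, hN3⟩ := exists_starCore_eq F σ fun e => uniqueEss_of_mem_Φ hess σ (hF e)
  set D := coreChain σ F.toRel with hD
  have hcnt := fun j => card_compl_inter_add_signCount σ (D j)
  have hpos : ∀ s, (0 : ℝ) < (signClass σ s).card := fun s => by exact_mod_cast hσ s
  have hNs : ∃ s, (1 - y) * (signClass σ s).card ≤ signCount σ (D N) s := by
    by_contra hcon
    push Not at hcon
    have h6 := card_eq_sum_inter_signClass σ (D N)ᶜ
    have h7 := card_eq_sum_inter_signClass σ Finset.univ
    simp only [Finset.univ_inter, Finset.card_univ, Fintype.card_fin] at h7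
    rw [hN1, h6, h7, Finset.mul_sum] at hy
    refine hy.not_ge (Finset.sum_le_sum fun s _ => ?_)
    have h5 : (((D N)ᶜ ∩ signClass σ s).card : ℝ) + signCount σ (D N) s = (signClass σ s).card := by
      exact_mod_cast hcnt N s
    linarith [hcon s]
  have hex : ∃ j, ∃ s, (1 - y) * (signClass σ s).card ≤ signCount σ (D j) s := ⟨N, hNs⟩
  obtain ⟨s, hs⟩ := Nat.find_spec hex
  have hle : Nat.find hex ≤ N := Nat.find_min' hex hNs
  set j := Nat.find hex with hj
  obtain ⟨i, hi⟩ : ∃ i, j = i + 1 := by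
    refine Nat.exists_eq_succ_of_ne_zero fun h0 => ?_
    rw [h0] at hs
    have h1 : signCount σ (D 0) s = 0 := by simp [signCount, hD, coreChain, delChain]
    rw [h1] at hs
    have := mul_pos (sub_pos.2 hy1) (hpos s)
    push_cast at hs
    linarith
  refine ⟨signCount σ (D j), s, fun s' => by have := hcnt j s'; omega, hs, fun s' => ?_,
    essNum_relabelTails σ F, ?_⟩
  · have h1 := Nat.find_min hex (m := i) (by omega)
    push Not at h1
    have h2 : signCount σ (D j) s' ≤ signCount σ (D i) s' + 1 := by
      have h3 : D j = D i ∪ pick (D i) (supported σ (D i)ᶜ F.toRel) := by rw [hi]; rfl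
      unfold signCount
      rw [h3, Finset.union_inter_distrib_right]
      refine (Finset.card_union_le _ _).trans (Nat.add_le_add_left ?_ _)
      exact (Finset.card_le_card Finset.inter_subset_left).trans (card_pick_le _ _)
    have h4 : (signCount σ (D j) s' : ℝ) ≤ signCount σ (D i) s' + 1 := by exact_mod_cast h2
    linarith [h1 s']
  · rw [hD, supported_relabelTails]
    have h8 : D j ∩ signClass σ s ⊆ signClass σ s \ supported σ (D j)ᶜ F.toRel := by
      intro v hv
      rw [Finset.mem_inter] at hv
      exact Finset.mem_sdiff.2 ⟨hv.2, Finset.disjoint_left.1 (hN3 j hle) hv.1⟩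
    exact_mod_cast Finset.card_le_card h8

/-! ### Exponentially unlikely events given a balanced assignment -/

/-- Either sign occurs between `(1/2 - δ) n` and `(1/2 + δ) n` times. -/
def Balanced (δ : ℝ) (σ : Fin n → ℤˣ) : Prop :=
  ∀ s, |((signClass σ s).card : ℝ) - n / 2| ≤ δ * n

/-- The event `Bad` has exponentially small probability in the planted model, uniformly over all
the assignments that are balanced up to some constant. -/
def ExpUnlikely (Υ : CSPModel k) (r : ℝ) (Bad : ∀ n M, CSP k n M → (Fin n → ℤˣ) → Prop) : Prop :=
  ∃ c > 0, ∃ δ > 0, ∀ᶠ n : ℕ in atTop, ∀ σ : Fin n → ℤˣ, Balanced δ σ →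
    Υ.condPr σ ⌊r * n⌋₊ (fun F => Bad n _ F σ) ≤ Real.exp (-(c * n))

lemma Balanced.mono {δ δ' : ℝ} (h : δ ≤ δ') {σ : Fin n → ℤˣ} (hσ : Balanced δ σ) :
    Balanced δ' σ := fun s => (hσ s).trans (mul_le_mul_of_nonneg_right h (Nat.cast_nonneg n))

lemma eventually_mul_le (c : ℝ) (hc : 0 < c) (x : ℝ) : ∀ᶠ n : ℕ in atTop, x ≤ c * n :=
  ((tendsto_natCast_atTop_atTop (R := ℝ)).const_mul_atTop hc).eventually_ge_atTop x

lemma Balanced.pos {δ : ℝ} (hδ : δ ≤ 1 / 6) (hn : 0 < n) {σ : Fin n → ℤˣ} (hσ : Balanced δ σ)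
    (s : ℤˣ) : (n : ℝ) / 3 ≤ (signClass σ s).card ∧ 0 < (signClass σ s).card := by
  have h1 := (abs_le.1 (hσ s)).1
  have hn' : (0 : ℝ) < n := by exact_mod_cast hn
  have h2 : δ * n ≤ 1 / 6 * n := mul_le_mul_of_nonneg_right hδ hn'.le
  have h3 : (n : ℝ) / 3 ≤ (signClass σ s).card := by linarith
  refine ⟨h3, ?_⟩
  have : (0 : ℝ) < (signClass σ s).card := by linarith
  exact_mod_cast this

lemma floor_mul_le_abs_mul (r : ℝ) (n : ℕ) : (⌊r * n⌋₊ : ℝ) ≤ |r| * n := by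
  have h1 : r * n ≤ |r| * n := mul_le_mul_of_nonneg_right (le_abs_self r) n.cast_nonneg
  exact (Nat.cast_le.2 (Nat.floor_le_floor h1)).trans (Nat.floor_le (by positivity))

/-- The factor lost in the comparison with the product measure (`condPr_le_relPr`) is at most
`exp (c n)`, with `c` as small as desired, for assignments that are sufficiently balanced. -/
lemma exists_comparison_cost (k : ℕ) (r : ℝ) {c δ₁ : ℝ} (hc : 0 < c) (hδ₁ : 0 < δ₁) :
    ∃ δ > 0, δ ≤ δ₁ ∧ ∀ᶠ n : ℕ in atTop, ∃ m : ℕ, 0 < m ∧ (m : ℝ) + k ≤ (1 / 2 - δ) * n ∧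
      (((1 / 2 + δ) * n / m) ^ k) ^ ⌊r * n⌋₊ ≤ Real.exp (c * n) := by
  have hcont : ContinuousAt (fun δ : ℝ => k * |r| * Real.log ((1 / 2 + δ) / (1 / 2 - 3 * δ))) 0 := by
    refine ContinuousAt.mul (by fun_prop) (ContinuousAt.log ?_ (by norm_num))
    exact ContinuousAt.div (by fun_prop) (by fun_prop) (by norm_num)
  have h1 : ∀ᶠ δ in 𝓝[>] (0 : ℝ), k * |r| * Real.log ((1 / 2 + δ) / (1 / 2 - 3 * δ)) < c := by
    refine (hcont.tendsto.mono_left nhdsWithin_le_nhds).eventually_lt_const ?_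
    norm_num
    exact hc
  obtain ⟨δ, hδc, hδ0, hδ⟩ :=
    (h1.and (Ioo_mem_nhdsGT (lt_min hδ₁ (show (0 : ℝ) < 1 / 12 by norm_num)))).exists
  have hδ12 : δ < 1 / 12 := hδ.trans_le (min_le_right _ _)
  have hδ0 : 0 < δ := hδ0
  refine ⟨δ, hδ0, (hδ.trans_le (min_le_left _ _)).le, ?_⟩
  filter_upwards [eventually_mul_le δ hδ0 k, eventually_mul_le δ hδ0 1, eventually_gt_atTop 0]
    with n hn1 hn2 hn3
  have hn : (0 : ℝ) < n := by exact_mod_cast hn3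
  have hm1 := Nat.floor_le (show 0 ≤ (1 / 2 - 2 * δ) * n by nlinarith)
  have hm2 := Nat.lt_floor_add_one ((1 / 2 - 2 * δ) * (n : ℝ))
  set m := ⌊(1 / 2 - 2 * δ) * (n : ℝ)⌋₊
  have hm3 : (1 / 2 - 3 * δ) * n ≤ m := by linarith
  have hq : 0 < 1 / 2 - 3 * δ := by linarith
  have hm4 : (0 : ℝ) < m := (mul_pos hq hn).trans_le hm3
  refine ⟨m, by exact_mod_cast hm4, by linarith, ?_⟩
  set R := (1 / 2 + δ) / (1 / 2 - 3 * δ) with hR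
  have hR1 : 1 ≤ R := by rw [hR, one_le_div hq]; linarith
  have hratio : (1 / 2 + δ) * n / m ≤ R := by
    rw [hR, div_le_div_iff₀ hm4 hq]
    nlinarith
  have hM := floor_mul_le_abs_mul r n
  calc (((1 / 2 + δ) * n / m) ^ k) ^ ⌊r * n⌋₊ ≤ (R ^ k) ^ ⌊r * n⌋₊ := by gcongr
    _ = Real.exp (⌊r * n⌋₊ * (k * Real.log R)) := by
        rw [Real.exp_nat_mul, Real.exp_nat_mul, Real.exp_log (by linarith)]
    _ ≤ Real.exp (c * n) := by
        rw [Real.exp_le_exp]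
        have hl := Real.log_nonneg hR1
        have e1 : (⌊r * n⌋₊ : ℝ) * (k * Real.log R) ≤ |r| * n * (k * Real.log R) :=
          mul_le_mul_of_nonneg_right hM (by positivity)
        have e2 := mul_le_mul_of_nonneg_right hδc.le hn.le
        linarith

lemma eventually_poly_le (r : ℝ) {c : ℝ} (hc : 0 < c) :
    ∀ᶠ n : ℕ in atTop, ((⌊r * n⌋₊ : ℝ) + 1) * ((n + 1) ^ 2 * 2) ≤ Real.exp (c * n) := by
  have h := (isLittleO_pow_exp_pos_mul_atTop (k := 3) hc).comp_tendsto
    (tendsto_natCast_atTop_atTop (R := ℝ))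
  have h8 : (0 : ℝ) < 1 / (8 * (|r| + 1)) := by positivity
  filter_upwards [h.bound h8, eventually_ge_atTop 1] with n hn hn1
  have hn1 : (1 : ℝ) ≤ n := by exact_mod_cast hn1
  simp only [Function.comp_apply, Real.norm_eq_abs, Real.abs_exp] at hn
  rw [abs_of_nonneg (by positivity), one_div, inv_mul_eq_div, le_div_iff₀ (by positivity)] at hn
  refine le_trans ?_ hn
  have hM := floor_mul_le_abs_mul r n
  have hr := abs_nonneg r
  calc ((⌊r * n⌋₊ : ℝ) + 1) * ((n + 1) ^ 2 * 2) ≤ ((|r| + 1) * n) * ((2 * n) ^ 2 * 2) := by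
        gcongr
        · nlinarith
        · linarith
    _ = _ := by ring

/-- An event is exponentially unlikely if it implies one of polynomially many events for
the relabelled instance that are exponentially unlikely under the product measure. -/
lemma expUnlikely_of_relPr (hsat : 0 < Υ.satMass) {r c δ₁ : ℝ} (hc : 0 < c) (hδ₁ : 0 < δ₁)
    (Bad : ∀ n M, CSP k n M → (Fin n → ℤˣ) → Prop)
    (E : ∀ n M, (Fin n → ℤˣ) → ℕ → (ℤˣ → ℕ) → ℤˣ → (Fin M → RelConstraint k n) → Prop)
    (h : ∀ᶠ n : ℕ in atTop, ∀ σ : Fin n → ℤˣ, Balanced δ₁ σ →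
      (∀ F : CSP k n ⌊r * n⌋₊, (∀ e, (F e).1 ∈ Υ.Φ) → Bad n _ F σ →
        ∃ m ≤ ⌊r * n⌋₊, ∃ (J : ℤˣ → ℕ) (s : ℤˣ), (∀ s', J s' ≤ (signClass σ s').card) ∧
          E n _ σ m J s (relabelTails σ F.toRel)) ∧
      ∀ m J s, (∀ s', J s' ≤ (signClass σ s').card) →
        Υ.relPr σ ⌊r * n⌋₊ (E n _ σ m J s) ≤ Real.exp (-(c * n))) :
    ExpUnlikely Υ r Bad := by
  obtain ⟨δ, hδ0, hδδ₁, hcost⟩ :=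
    exists_comparison_cost k r (show 0 < c / 4 by linarith) hδ₁
  refine ⟨c / 2, by linarith, δ, hδ0, ?_⟩
  filter_upwards [h, hcost, eventually_poly_le r (show 0 < c / 4 by linarith)] with n hn hcost hpoly
  intro σ hσ
  obtain ⟨hbad, hE⟩ := hn σ (hσ.mono hδδ₁)
  obtain ⟨m, hm0, hmk, hcost⟩ := hcost
  set M := ⌊r * n⌋₊
  have hms : ∀ s, m + k ≤ (signClass σ s).card := by
    intro s
    have h1 := (abs_le.1 (hσ s)).1
    have h2 : (m : ℝ) + k ≤ (signClass σ s).card := by linarith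
    exact_mod_cast h2
  have hB : ∀ s, ((signClass σ s).card : ℝ) ≤ (1 / 2 + δ) * n := by
    intro s
    have h1 := (abs_le.1 (hσ s)).2
    linarith
  let E' : Fin (M + 1) × (ℤˣ → Fin (n + 1)) × ℤˣ → (Fin M → RelConstraint k n) → Prop :=
    fun i F => (∀ s', (i.2.1 s' : ℕ) ≤ (signClass σ s').card) ∧
      E n M σ i.1 (fun s => i.2.1 s) i.2.2 F
  have h1 := condPr_le_relPr hsat σ hm0 hms hB (fun F : CSP k n M => Bad n M F σ)
    (fun F => ∃ i, E' i F) (by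
      intro F hF hFbad
      obtain ⟨m', hm', J, s, hJ, hEF⟩ := hbad F hF hFbad
      have hJn : ∀ s, J s < n + 1 := fun s => by
        have h2 := hJ s
        have h3 := Finset.card_le_univ (signClass σ s)
        rw [Fintype.card_fin] at h3
        omega
      exact ⟨(⟨m', by omega⟩, fun s => ⟨J s, hJn s⟩, s), hJ, hEF⟩)
  have h2 : Υ.relPr σ M (fun F => ∃ i, E' i F) ≤
      Fintype.card (Fin (M + 1) × (ℤˣ → Fin (n + 1)) × ℤˣ) * Real.exp (-(c * n)) := by
    refine relPr_exists_le σ E' fun i => ?_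
    by_cases hi : ∀ s', (i.2.1 s' : ℕ) ≤ (signClass σ s').card
    · have := hE i.1 (fun s => i.2.1 s) i.2.2 hi
      simpa only [E', hi, implies_true, true_and] using this
    · have h0 : Υ.relPr σ M (E' i) = 0 := by
        simp only [CSPModel.relPr, E', hi, false_and, if_false, Finset.sum_const_zero]
      rw [h0]
      positivity
  have h3 : (Fintype.card (Fin (M + 1) × (ℤˣ → Fin (n + 1)) × ℤˣ) : ℝ) ≤ Real.exp (c / 4 * n) := by
    refine le_trans (le_of_eq ?_) hpoly
    simp [Fintype.card_pi]
  refine h1.trans ?_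
  calc _ ≤ Real.exp (c / 4 * n) * (Real.exp (c / 4 * n) * Real.exp (-(c * n))) := by
        refine mul_le_mul hcost (h2.trans (mul_le_mul_of_nonneg_right h3 (Real.exp_pos _).le)) ?_
          (Real.exp_pos _).le
        exact Finset.sum_nonneg fun F _ => by
          split_ifs
          · exact Finset.prod_nonneg fun e _ => relWeight_nonneg σ _
          · exact le_rfl
    _ = Real.exp (-(c / 2 * n)) := by
        rw [← Real.exp_add, ← Real.exp_add]; ring_nf

lemma relPr_mono (σ : Fin n → ℤˣ) {E E' : (Fin M → RelConstraint k n) → Prop}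
    (h : ∀ F, E F → E' F) : Υ.relPr σ M E ≤ Υ.relPr σ M E' := by
  refine Finset.sum_le_sum fun F _ => ?_
  have hprod : 0 ≤ ∏ e, Υ.relWeight σ (F e) :=
    Finset.prod_nonneg fun e _ => relWeight_nonneg σ _
  by_cases hF : E F
  · rw [if_pos hF, if_pos (h F hF)]
  · rw [if_neg hF]
    split_ifs
    exacts [hprod, le_rfl]

lemma laterVerts_density (σ : Fin n → ℤˣ) (hσ : ∀ s, 0 < (signClass σ s).card) {J : ℤˣ → ℕ}
    (hJ : ∀ s, J s ≤ (signClass σ s).card) (s : ℤˣ) :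
    ((laterVerts σ J ∩ signClass σ s).card : ℝ) / (signClass σ s).card =
      1 - J s / (signClass σ s).card := by
  have : ((signClass σ s).card : ℝ) ≠ 0 := by exact_mod_cast (hσ s).ne'
  rw [card_laterVerts_inter, Nat.cast_sub (hJ s)]
  field_simp

/-- The *-core is unlikely to have density `y₀` or more if there is no fixed point above `y₀`. -/
lemma expUnlikely_large_core (hess : Υ.OneEssential) (hsym : Υ.Symmetric) (hsat : 0 < Υ.satMass)
    (r : ℝ) {α y₀ : ℝ} (hα : 0 ≤ α) (hy₀ : 0 < y₀)
    (hfix : ∀ y, y₀ ≤ y → y ≤ 1 → 1 - Real.exp (-(α * y ^ (k - 1))) < y) {f : ℕ → ℝ}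
    (hf : f =o[atTop] (fun n : ℕ => (n : ℝ))) :
    ExpUnlikely Υ r fun n _ F σ => |((Gam F σ).edges.card : ℝ) - α * n| ≤ f n ∧
      y₀ * n < (Gam F σ).starCore.verts.card := by
  obtain ⟨l, hl0, hl1, c, hc0, N₀, hgap⟩ := exists_gap_upper hα hy₀ hfix
  -- half of the slack `l` is for the imbalance of the classes, the other half for `f n`
  set δ := min (1 / 6) (l / (4 * (α + l))) with hδ
  have hδ0 : 0 < δ := lt_min (by norm_num) (by positivity)
  have hδ6 : δ ≤ 1 / 6 := min_le_left _ _
  have hδl : δ * (4 * (α + l)) ≤ l := by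
    rw [← le_div_iff₀ (by positivity)]; exact min_le_right _ _
  refine expUnlikely_of_relPr hsat (c := l * c / 3) (by positivity) hδ0 _
    (fun n M σ m J s F => ((m : ℝ) - α * n ≤ f n ∧ (J s : ℝ) ≤ (1 - y₀) * (signClass σ s).card ∧
      (∀ s', (J s : ℝ) / (signClass σ s).card ≤ J s' / (signClass σ s').card)) ∧
      SupportedEvent σ m J s F) ?_
  filter_upwards [hf.bound (show 0 < l / 2 by linarith), eventually_gt_atTop 0,
    eventually_mul_le (1 / 3) (by norm_num) N₀] with n hfn hn0 hnN σ hσ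
  have hpos := fun s => (hσ.pos hδ6 hn0 s).2
  have hn3 := fun s => (hσ.pos hδ6 hn0 s).1
  have hn : (0 : ℝ) < n := by exact_mod_cast hn0
  constructor
  · rintro F hF ⟨hFm, hFy⟩
    obtain ⟨J, s, hJ, hJs, hJmin, hE⟩ := exists_supportedEvent hess F hF σ hpos hFy
    refine ⟨(Gam F σ).edges.card, ?_, J, s, hJ, ⟨(abs_le.1 hFm).2, hJs, hJmin⟩, hE⟩
    exact (Finset.card_le_univ _).trans (by simp)
  · intro m J s hJ
    by_cases hcond : (m : ℝ) - α * n ≤ f n ∧ (J s : ℝ) ≤ (1 - y₀) * (signClass σ s).card ∧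
      (∀ s', (J s : ℝ) / (signClass σ s).card ≤ J s' / (signClass σ s').card)
    · obtain ⟨hm, hJs, hJmin⟩ := hcond
      have hposR : (0 : ℝ) < (signClass σ s).card := by exact_mod_cast hpos s
      set N : ℝ := ((signClass σ s).card : ℝ) with hN
      set y := 1 - J s / N with hy
      have hy0 : y₀ ≤ y := by
        have : (J s : ℝ) / N ≤ 1 - y₀ := by rwa [div_le_iff₀ hposR]
        linarith
      have hy1 : y ≤ 1 := by
        have : 0 ≤ (J s : ℝ) / N := by positivity
        linarith
      have hJy : (J s : ℝ) = (1 - y) * N := by rw [hy]; field_simp; ring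
      have hmN : (m : ℝ) ≤ (α + l) * (2 * N) := by
        have e1 := (abs_le.1 (hσ s)).1
        have e2 : f n ≤ l / 2 * n := by
          have := (le_abs_self _).trans hfn
          rwa [Real.norm_eq_abs, abs_of_pos hn] at this
        have e3 : (α + l) * (n - 2 * (δ * n)) ≤ (α + l) * (2 * N) :=
          mul_le_mul_of_nonneg_left (by linarith) (by linarith)
        have e4 := mul_le_mul_of_nonneg_right hδl hn.le
        nlinarith
      have hgap' := hgap N (by linarith [hn3 s]) y hy0 hy1 m hmN
      have hdens := laterVerts_density σ hpos hJ
      have hb := relPr_unsupported_le hess hsym hsat σ hpos (laterVerts σ J) (hy₀.le.trans hy0) hy1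
        (fun s' => by rw [hdens]; linarith [hJmin s']) s hl0.le hl1 m (z := J s)
        (M := ⌊r * n⌋₊) (SupportedEvent σ m J s) (fun F hF => hF)
      refine ((relPr_mono σ fun F hF => hF.2).trans hb).trans ?_
      rw [Real.exp_le_exp, hJy]
      have e1 : c * N ≤ (1 - (1 + l) * (y ^ (k - 1) / (2 * N))) ^ m * N - (1 - y) * N := by
        rw [← sub_mul]
        exact mul_le_mul_of_nonneg_right hgap' hposR.le
      have e2 := mul_le_mul_of_nonneg_left e1 hl0.le
      have e3 := mul_le_mul_of_nonneg_left (hn3 s) (mul_pos hl0 hc0).le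
      linarith
    · have h0 : Υ.relPr σ ⌊r * n⌋₊ (fun F => ((m : ℝ) - α * n ≤ f n ∧
          (J s : ℝ) ≤ (1 - y₀) * (signClass σ s).card ∧
          (∀ s', (J s : ℝ) / (signClass σ s).card ≤ J s' / (signClass σ s').card)) ∧
          SupportedEvent σ m J s F) = 0 := by
        simp only [CSPModel.relPr, hcond, false_and, if_false, Finset.sum_const_zero]
      rw [h0]
      positivity

/-- The *-core is unlikely to have a density below `y₀` if `y₀` is mapped to a larger value. -/
lemma expUnlikely_small_core (hess : Υ.OneEssential) (hsym : Υ.Symmetric) (hsat : 0 < Υ.satMass)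
    (r : ℝ) {α y₀ : ℝ} (hα : 0 < α) (hy₀ : 0 < y₀) (hy₁ : y₀ < 1)
    (hfix : y₀ < 1 - Real.exp (-(α * y₀ ^ (k - 1)))) {f : ℕ → ℝ}
    (hf : f =o[atTop] (fun n : ℕ => (n : ℝ))) :
    ExpUnlikely Υ r fun n _ F σ => |((Gam F σ).edges.card : ℝ) - α * n| ≤ f n ∧
      ((Gam F σ).starCore.verts.card : ℝ) < y₀ * n := by
  obtain ⟨l, hl0, hl1, hly, c, hc0, hgap⟩ := exists_gap_lower hy₀ hfix
  -- half of the slack `l` is for the imbalance of the classes, the other half for `f n`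
  set δ := min (1 / 6) (l / (4 * (α + l))) with hδ
  have hδ0 : 0 < δ := lt_min (by norm_num) (by positivity)
  have hδ6 : δ ≤ 1 / 6 := min_le_left _ _
  have hδl : δ * (4 * (α + l)) ≤ l := by
    rw [← le_div_iff₀ (by positivity)]; exact min_le_right _ _
  refine expUnlikely_of_relPr hsat (c := l * c / 3) (by positivity) hδ0 _
    (fun n M σ m J s F => (-f n ≤ (m : ℝ) - α * n ∧ (1 - y₀) * (signClass σ s).card ≤ J s ∧
      (∀ s', (J s' : ℝ) ≤ (1 - y₀) * (signClass σ s').card + 1)) ∧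
      UnsupportedEvent σ m J s F) ?_
  filter_upwards [hf.bound (show 0 < l / 2 by linarith), eventually_gt_atTop 0,
    eventually_mul_le (1 / 3) (by norm_num) 1,
    eventually_mul_le (l * (1 / 3)) (by positivity) 1] with n hfn hn0 hn1 hnl σ hσ
  have hpos := fun s => (hσ.pos hδ6 hn0 s).2
  have hn3 := fun s => (hσ.pos hδ6 hn0 s).1
  have hn : (0 : ℝ) < n := by exact_mod_cast hn0
  constructor
  · rintro F hF ⟨hFm, hFy⟩
    obtain ⟨J, s, hJ, hJs, hJmax, hE⟩ := exists_unsupportedEvent hess F hF σ hpos hy₁ hFy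
    refine ⟨(Gam F σ).edges.card, ?_, J, s, hJ, ⟨(abs_le.1 hFm).1, hJs, hJmax⟩, hE⟩
    exact (Finset.card_le_univ _).trans (by simp)
  · intro m J s hJ
    by_cases hcond : -f n ≤ (m : ℝ) - α * n ∧ (1 - y₀) * (signClass σ s).card ≤ J s ∧
      (∀ s', (J s' : ℝ) ≤ (1 - y₀) * (signClass σ s').card + 1)
    · obtain ⟨hm, hJs, hJmax⟩ := hcond
      have hposR : ∀ s, (0 : ℝ) < (signClass σ s).card := fun s => by exact_mod_cast hpos s
      set N : ℝ := ((signClass σ s).card : ℝ) with hN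
      have hmN : (α - l) * (2 * N) ≤ m := by
        have e1 := abs_le.1 (hσ s)
        have e2 : f n ≤ l / 2 * n := by
          have := (le_abs_self _).trans hfn
          rwa [Real.norm_eq_abs, abs_of_pos hn] at this
        have e3 : α * (2 * N) ≤ α * (n + 2 * (δ * n)) :=
          mul_le_mul_of_nonneg_left (by linarith [e1.2]) hα.le
        have e4 : l * (n - 2 * (δ * n)) ≤ l * (2 * N) :=
          mul_le_mul_of_nonneg_left (by linarith [e1.1]) hl0.le
        have e5 := mul_le_mul_of_nonneg_right hδl hn.le
        nlinarith
      have hgap' := hgap N (by linarith [hn3 s]) m hmN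
      have hdens := laterVerts_density σ hpos hJ
      have hb := relPr_unsupported_ge hess hsym hsat σ hpos (laterVerts σ J) (y := y₀ - l)
        (by linarith) (by linarith)
        (fun s' => by
          rw [hdens]
          have e1 : (J s' : ℝ) / (signClass σ s').card ≤ 1 - y₀ + l := by
            rw [div_le_iff₀ (hposR s')]
            have := mul_le_mul_of_nonneg_left (hn3 s') hl0.le
            linarith [hJmax s']
          linarith) s hl0.le hl1 m (z := J s)
        (M := ⌊r * n⌋₊) (UnsupportedEvent σ m J s) (fun F hF => hF)
      refine ((relPr_mono σ fun F hF => hF.2).trans hb).trans ?_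
      rw [Real.exp_le_exp]
      have e1 : (1 - (1 - l) * ((y₀ - l) ^ (k - 1) / (2 * N))) ^ m * N ≤ (1 - y₀ - c) * N :=
        mul_le_mul_of_nonneg_right hgap' (hposR s).le
      have e2 : (1 - (1 - l) * ((y₀ - l) ^ (k - 1) / (2 * N))) ^ m * N - J s ≤ -(c * N) := by
        linarith
      have e3 := mul_le_mul_of_nonneg_left e2 hl0.le
      have e4 := mul_le_mul_of_nonneg_left (hn3 s) (mul_pos hl0 hc0).le
      linarith
    · have h0 : Υ.relPr σ ⌊r * n⌋₊ (fun F => (-f n ≤ (m : ℝ) - α * n ∧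
          (1 - y₀) * (signClass σ s).card ≤ J s ∧
          (∀ s', (J s' : ℝ) ≤ (1 - y₀) * (signClass σ s').card + 1)) ∧
          UnsupportedEvent σ m J s F) = 0 := by
        simp only [CSPModel.relPr, hcond, false_and, if_false, Finset.sum_const_zero]
      rw [h0]
      positivity

/-! ### From balanced assignments to the planted model -/

/-- The moment generating function of a sum of independent random signs. -/
lemma sum_exp_mul_sum_sign (n : ℕ) (θ : ℝ) :
    ∑ σ : Fin n → ℤˣ, Real.exp (θ * ∑ v, ((σ v : ℤ) : ℝ)) = (2 * Real.cosh θ) ^ n := by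
  have h1 : ∑ u : ℤˣ, Real.exp (θ * ((u : ℤ) : ℝ)) = 2 * Real.cosh θ := by
    rw [show (Finset.univ : Finset ℤˣ) = {1, -1} from rfl, Finset.sum_pair (by decide),
      Real.cosh_eq]
    simp
    ring
  calc _ = ∑ σ : Fin n → ℤˣ, ∏ v, Real.exp (θ * ((σ v : ℤ) : ℝ)) := by
        refine Finset.sum_congr rfl fun σ _ => ?_
        rw [← Real.exp_sum, Finset.mul_sum]
    _ = _ := by
        rw [← Fintype.prod_sum fun (_ : Fin n) (u : ℤˣ) => Real.exp (θ * ((u : ℤ) : ℝ))]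
        simp only [h1, Finset.prod_const, Finset.card_univ, Fintype.card_fin]

lemma card_signClass_sub (σ : Fin n → ℤˣ) (s : ℤˣ) :
    ((signClass σ s).card : ℝ) - n / 2 = ((s : ℤ) : ℝ) * (∑ v, ((σ v : ℤ) : ℝ)) / 2 := by
  have h1 : ((signClass σ s).card : ℝ) = ∑ v, (if σ v = s then (1 : ℝ) else 0) := by
    rw [Finset.sum_boole]; rfl
  have h2 : (n : ℝ) = ∑ _v : Fin n, (1 : ℝ) := by simp
  rw [h1, h2, Finset.sum_div, ← Finset.sum_sub_distrib, Finset.mul_sum, Finset.sum_div]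
  refine Finset.sum_congr rfl fun v _ => ?_
  rcases Int.units_eq_one_or s with rfl | rfl <;>
    rcases Int.units_eq_one_or (σ v) with h | h <;> rw [h]
  · norm_num
  · rw [if_neg (by decide)]; norm_num
  · rw [if_neg (by decide)]; norm_num
  · norm_num

open scoped Classical in
/-- A uniformly random assignment is balanced, except with exponentially small probability. -/
lemma prob_not_balanced_le (n : ℕ) {δ : ℝ} (hδ : 0 < δ) :
    ∑ σ : Fin n → ℤˣ, (1 / 2 : ℝ) ^ n * (if Balanced δ σ then 0 else 1) ≤
      2 * Real.exp (-(2 * δ ^ 2 * n)) := by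
  have h1 : ∀ σ : Fin n → ℤˣ, (if Balanced δ σ then (0 : ℝ) else 1) ≤
      Real.exp (-(2 * δ * (2 * δ * n))) * (Real.exp (2 * δ * ∑ v, ((σ v : ℤ) : ℝ)) +
        Real.exp (-(2 * δ) * ∑ v, ((σ v : ℤ) : ℝ))) := by
    intro σ
    split_ifs with hσ
    · positivity
    · unfold Balanced at hσ
      push Not at hσ
      obtain ⟨s, hs⟩ := hσ
      rw [card_signClass_sub] at hs
      set S := ∑ v, ((σ v : ℤ) : ℝ)
      have hS : 2 * δ * n < |S| := by
        have : |((s : ℤ) : ℝ) * S / 2| = |S| / 2 := by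
          rcases Int.units_eq_one_or s with rfl | rfl <;> simp [abs_div]
        rw [this] at hs
        linarith
      rw [mul_add, ← Real.exp_add, ← Real.exp_add]
      rcases lt_abs.1 hS with h | h
      · have e1 := Real.one_le_exp (x := -(2 * δ * (2 * δ * n)) + 2 * δ * S) (by nlinarith)
        have e2 := Real.exp_pos (-(2 * δ * (2 * δ * n)) + -(2 * δ) * S)
        linarith
      · have e1 := Real.one_le_exp (x := -(2 * δ * (2 * δ * n)) + -(2 * δ) * S) (by nlinarith)
        have e2 := Real.exp_pos (-(2 * δ * (2 * δ * n)) + 2 * δ * S)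
        linarith
  calc _ ≤ ∑ σ : Fin n → ℤˣ, (1 / 2 : ℝ) ^ n *
        (Real.exp (-(2 * δ * (2 * δ * n))) * (Real.exp (2 * δ * ∑ v, ((σ v : ℤ) : ℝ)) +
        Real.exp (-(2 * δ) * ∑ v, ((σ v : ℤ) : ℝ)))) :=
        Finset.sum_le_sum fun σ _ => mul_le_mul_of_nonneg_left (h1 σ) (by positivity)
    _ = 2 * (Real.exp (-(2 * δ * (2 * δ * n))) * Real.cosh (2 * δ) ^ n) := by
        rw [← Finset.mul_sum, ← Finset.mul_sum, Finset.sum_add_distrib, sum_exp_mul_sum_sign,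
          sum_exp_mul_sum_sign, Real.cosh_neg, mul_pow, one_div, inv_pow]
        field_simp
        ring
    _ ≤ 2 * (Real.exp (-(2 * δ * (2 * δ * n))) * Real.exp ((2 * δ) ^ 2 / 2) ^ n) := by
        have := (Real.cosh_pos (2 * δ)).le
        gcongr
        exact Real.cosh_le_exp_half_sq _
    _ = _ := by
        rw [← Real.exp_nat_mul, ← Real.exp_add]
        ring_nf

lemma condPr_mono (σ : Fin n → ℤˣ) {E E' : CSP k n M → Prop} (h : ∀ F, E F → E' F) :
    Υ.condPr σ M E ≤ Υ.condPr σ M E' := by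
  refine Finset.sum_le_sum fun F _ => ?_
  have hprod : 0 ≤ ∏ e, Υ.condWeight σ (F e) :=
    Finset.prod_nonneg fun e _ => condWeight_nonneg σ _
  by_cases hF : E F
  · rw [if_pos hF, if_pos (h F hF)]
  · rw [if_neg hF]
    split_ifs
    exacts [hprod, le_rfl]

lemma ExpUnlikely.mono {r : ℝ} {Bad Bad' : ∀ n M, CSP k n M → (Fin n → ℤˣ) → Prop}
    (h : ExpUnlikely Υ r Bad) (hle : ∀ᶠ n in atTop, ∀ M F σ, Bad' n M F σ → Bad n M F σ) :
    ExpUnlikely Υ r Bad' := by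
  obtain ⟨c, hc, δ, hδ, h⟩ := h
  refine ⟨c, hc, δ, hδ, ?_⟩
  filter_upwards [h, hle] with n hn hle σ hσ
  exact (condPr_mono σ fun F hF => hle _ F σ hF).trans (hn σ hσ)

lemma ExpUnlikely.or {r : ℝ} {Bad Bad' : ∀ n M, CSP k n M → (Fin n → ℤˣ) → Prop}
    (h : ExpUnlikely Υ r Bad) (h' : ExpUnlikely Υ r Bad') :
    ExpUnlikely Υ r fun n M F σ => Bad n M F σ ∨ Bad' n M F σ := by
  obtain ⟨c, hc, δ, hδ, h⟩ := h
  obtain ⟨c', hc', δ', hδ', h'⟩ := h'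
  have hcc : 0 < min c c' := lt_min hc hc'
  refine ⟨min c c' / 2, by linarith, min δ δ', lt_min hδ hδ', ?_⟩
  filter_upwards [h, h', eventually_mul_le (min c c' / 2) (by linarith) 1] with n hn hn' hn1 σ hσ
  have h1 := hn σ (hσ.mono (min_le_left _ _))
  have h2 := hn' σ (hσ.mono (min_le_right _ _))
  have hor : Υ.condPr σ ⌊r * n⌋₊ (fun F => Bad n _ F σ ∨ Bad' n _ F σ) ≤
      Υ.condPr σ ⌊r * n⌋₊ (fun F => Bad n _ F σ) + Υ.condPr σ ⌊r * n⌋₊ (fun F => Bad' n _ F σ) := by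
    unfold CSPModel.condPr
    rw [← Finset.sum_add_distrib]
    refine Finset.sum_le_sum fun F _ => ?_
    have hprod : 0 ≤ ∏ e, Υ.condWeight σ (F e) :=
      Finset.prod_nonneg fun e _ => condWeight_nonneg σ _
    by_cases hF : Bad n _ F σ <;> by_cases hF' : Bad' n _ F σ <;> simp [hF, hF', hprod]
  have hn0 : (0 : ℝ) ≤ n := n.cast_nonneg
  have e1 : Real.exp (-(c * n)) ≤ Real.exp (-(min c c' * n)) :=
    Real.exp_le_exp.2 (neg_le_neg (mul_le_mul_of_nonneg_right (min_le_left _ _) hn0))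
  have e2 : Real.exp (-(c' * n)) ≤ Real.exp (-(min c c' * n)) :=
    Real.exp_le_exp.2 (neg_le_neg (mul_le_mul_of_nonneg_right (min_le_right _ _) hn0))
  have e3 : Real.exp (-(min c c' * n)) =
      Real.exp (-(min c c' / 2 * n)) * Real.exp (-(min c c' / 2 * n)) := by
    rw [← Real.exp_add]; ring_nf
  have e4 : Real.exp (-(min c c' / 2 * n)) ≤ 1 / 2 := by
    have e5 := Real.add_one_le_exp (min c c' / 2 * n)
    rw [Real.exp_neg, ← one_div]
    exact one_div_le_one_div_of_le two_pos (by linarith)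
  have e5 := mul_le_mul_of_nonneg_left e4 (Real.exp_pos (-(min c c' / 2 * n))).le
  linarith

/-- The complement of an exponentially unlikely event has probability at least `1 - exp (-g n)` in
the planted model, for every sublinear function `g`. -/
lemma ExpUnlikely.eventually_le_plantedPr (hsat : 0 < Υ.satMass) {r : ℝ}
    {Bad : ∀ n M, CSP k n M → (Fin n → ℤˣ) → Prop} (h : ExpUnlikely Υ r Bad) {g : ℕ → ℝ}
    (hg : g =o[atTop] (fun n : ℕ => (n : ℝ))) :
    ∀ᶠ n : ℕ in atTop, 1 - Real.exp (-g n) ≤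
      Υ.plantedPr n ⌊r * n⌋₊ (fun F σ => ¬ Bad n _ F σ) := by
  classical
  obtain ⟨c, hc, δ', hδ', h⟩ := h
  set δ := min δ' (1 / 6) with hδ
  have hδ0 : 0 < δ := lt_min hδ' (by norm_num)
  set c' := min c (2 * δ ^ 2) with hc'
  have hc'0 : 0 < c' := lt_min hc (by positivity)
  filter_upwards [h, hg.bound (show 0 < c' / 2 by linarith), eventually_gt_atTop 0,
    eventually_mul_le (c' / 2) (by linarith) 2, eventually_mul_le (1 / 3) (by norm_num) (1 + k),
    eventually_ge_atTop k] with n hn hgn hn0 hn2 hnk hkn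
  have hnpos : (0 : ℝ) < n := by exact_mod_cast hn0
  have hbal : ∀ σ : Fin n → ℤˣ, (1 / 2 : ℝ) ^ n * (1 - Real.exp (-(c * n))) -
      (1 / 2 : ℝ) ^ n * (if Balanced δ σ then 0 else 1) ≤
      (1 / 2 : ℝ) ^ n * Υ.condPr σ ⌊r * n⌋₊ (fun F => ¬ Bad n _ F σ) := by
    intro σ
    rw [← mul_sub]
    refine mul_le_mul_of_nonneg_left ?_ (by positivity)
    split_ifs with hσ
    · have hm : ∀ s, 1 + k ≤ (signClass σ s).card := by
        intro s
        have := (hσ.pos (min_le_right _ _) hn0 s).1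
        have h1 : ((1 : ℝ) + k) ≤ (signClass σ s).card := by linarith
        exact_mod_cast h1
      rw [condPr_eq_one_sub hsat σ one_pos hm]
      simp only [not_not]
      have := hn σ (hσ.mono (min_le_left _ _))
      linarith
    · have := condPr_nonneg (Υ := Υ) σ (fun F : CSP k n ⌊r * n⌋₊ => ¬ Bad n _ F σ)
      have := Real.exp_pos (-(c * n))
      linarith
  rw [plantedPr_eq hkn]
  refine le_trans ?_ (Finset.sum_le_sum fun σ _ => hbal σ)
  rw [Finset.sum_sub_distrib, Finset.sum_const, nsmul_eq_mul]
  have hcard : ((Finset.univ : Finset (Fin n → ℤˣ)).card : ℝ) * ((1 / 2 : ℝ) ^ n *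
      (1 - Real.exp (-(c * n)))) = 1 - Real.exp (-(c * n)) := by
    have : ((Finset.univ : Finset (Fin n → ℤˣ)).card : ℝ) * (1 / 2 : ℝ) ^ n = 1 := by
      simp
    rw [← mul_assoc, this, one_mul]
  rw [hcard]
  have h1 := prob_not_balanced_le n hδ0
  have e1 : Real.exp (-(c * n)) ≤ Real.exp (-(c' * n)) :=
    Real.exp_le_exp.2 (neg_le_neg (mul_le_mul_of_nonneg_right (min_le_left _ _) hnpos.le))
  have e2 : Real.exp (-(2 * δ ^ 2 * n)) ≤ Real.exp (-(c' * n)) :=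
    Real.exp_le_exp.2 (neg_le_neg (mul_le_mul_of_nonneg_right (min_le_right _ _) hnpos.le))
  have e3 : 3 * Real.exp (-(c' * n)) ≤ Real.exp (-g n) := by
    have e4 : g n ≤ c' / 2 * n := by
      have := (le_abs_self _).trans hgn
      rwa [Real.norm_eq_abs, abs_of_pos hnpos] at this
    calc 3 * Real.exp (-(c' * n)) ≤ Real.exp 2 * Real.exp (-(c' * n)) := by
          gcongr
          linarith [Real.add_one_le_exp (2 : ℝ)]
      _ ≤ Real.exp (-g n) := by
          rw [← Real.exp_add, Real.exp_le_exp]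
          linarith
  linarith

lemma plantedPr_mono (hkn : k ≤ n) {E E' : CSP k n M → (Fin n → ℤˣ) → Prop}
    (h : ∀ F σ, E F σ → E' F σ) : Υ.plantedPr n M E ≤ Υ.plantedPr n M E' := by
  rw [plantedPr_eq hkn, plantedPr_eq hkn]
  exact Finset.sum_le_sum fun σ _ => mul_le_mul_of_nonneg_left
    (condPr_mono σ fun F => h F σ) (by positivity)

/-- A property that holds eventually with the error `ε n`, for every `ε > 0`, holds eventually with
some sublinear error. -/
lemma exists_isLittleO_of_forall (P : ℕ → ℝ → Prop)
    (hmono : ∀ᶠ n in atTop, ∀ x x', x ≤ x' → P n x → P n x')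
    (h : ∀ ε > 0, ∀ᶠ n : ℕ in atTop, P n (ε * n)) :
    ∃ e : ℕ → ℝ, e =o[atTop] (fun n : ℕ => (n : ℝ)) ∧ ∀ᶠ n in atTop, P n (e n) := by
  set S : ℕ → Set ℝ := fun n => {ε | 0 < ε ∧ P n (ε * n)} with hS
  have hbdd : ∀ n, BddBelow (S n) := fun n => ⟨0, fun ε hε => hε.1.le⟩
  set d : ℕ → ℝ := fun n => sInf (S n) + 1 / ((n : ℝ) + 1) with hd
  have hd0 : Tendsto d atTop (𝓝 0) := by
    have h1 : Tendsto (fun n => sInf (S n)) atTop (𝓝 0) := by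
      rw [Metric.tendsto_nhds]
      intro ε hε
      filter_upwards [h (ε / 2) (by linarith)] with n hn
      have h2 : sInf (S n) ≤ ε / 2 := csInf_le (hbdd n) ⟨by linarith, hn⟩
      have h3 : 0 ≤ sInf (S n) := Real.sInf_nonneg fun x hx => hx.1.le
      rw [Real.dist_eq, sub_zero, abs_of_nonneg h3]
      linarith
    simpa only [add_zero] using h1.add tendsto_one_div_add_atTop_nhds_zero_nat
  refine ⟨fun n => d n * n, ?_, ?_⟩
  · simpa using ((isLittleO_one_iff ℝ).2 hd0).mul_isBigO (isBigO_refl (fun n : ℕ => (n : ℝ)) atTop)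
  · filter_upwards [hmono, h 1 one_pos] with n hmono hn
    obtain ⟨ε, hε, hlt⟩ := exists_lt_of_csInf_lt (s := S n) ⟨1, one_pos, hn⟩
      (show sInf (S n) < d n by
        have : (0 : ℝ) < 1 / ((n : ℝ) + 1) := by positivity
        simp only [hd]; linarith)
    exact hmono _ _ (mul_le_mul_of_nonneg_right hlt.le n.cast_nonneg) hε.2

end RandomCSP

end

theorem lemma4p1 {k : ℕ} (hk : 1 ≤ k) (Υ : RandomCSP.CSPModel k)
    (hess : Υ.OneEssential) (hsym : Υ.Symmetric)
    (hsat : ∃ φ ∈ Υ.Φ, ∃ s : Fin k → ℤˣ, φ s = true)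
    (r : ℝ) (hr : 0 < r) (α : ℝ)
    (f g : ℕ → ℝ) (hf : f =o[atTop] (fun n : ℕ => (n : ℝ)))
    (hg : g =o[atTop] (fun n : ℕ => (n : ℝ))) :
    (RandomCSP.alphaK k < α →
      ∃ h : ℕ → ℝ, h =o[atTop] (fun n : ℕ => (n : ℝ)) ∧
        ∀ᶠ n : ℕ in atTop,
          1 - Real.exp (-g n) ≤ Υ.plantedPr n ⌊r * n⌋₊ (fun F σ =>
            |((RandomCSP.Gam F σ).edges.card : ℝ) - α * n| ≤ f n →
              |((RandomCSP.Gam F σ).starCore.verts.card : ℝ) - RandomCSP.rhoK k α * n| ≤ h n)) ∧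
    (α < RandomCSP.alphaK k →
      ∃ h : ℕ → ℝ, h =o[atTop] (fun n : ℕ => (n : ℝ)) ∧
        ∀ᶠ n : ℕ in atTop,
          1 - Real.exp (-g n) ≤ Υ.plantedPr n ⌊r * n⌋₊ (fun F σ =>
            |((RandomCSP.Gam F σ).edges.card : ℝ) - α * n| ≤ f n →
              ((RandomCSP.Gam F σ).starCore.verts.card : ℝ) ≤ h n)) := by
  have hsat' := RandomCSP.satMass_pos hsat
  constructor
  · intro hα
    refine RandomCSP.exists_isLittleO_of_forall (fun n x => 1 - Real.exp (-g n) ≤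
      Υ.plantedPr n ⌊r * n⌋₊ (fun F σ =>
        |((RandomCSP.Gam F σ).edges.card : ℝ) - α * n| ≤ f n →
          |((RandomCSP.Gam F σ).starCore.verts.card : ℝ) - RandomCSP.rhoK k α * n| ≤ x)) ?_ ?_
    · filter_upwards [eventually_ge_atTop k] with n hn x x' hx h1
      exact h1.trans (RandomCSP.plantedPr_mono hn fun F σ h2 h3 => (h2 h3).trans hx)
    · intro ε hε
      have hα0 : 0 < α := (RandomCSP.alphaK_nonneg k).trans_lt hα
      have hρ := RandomCSP.rhoK_pos hα
      obtain ⟨y₀, hy0, hy1, hyε, hy⟩ := RandomCSP.exists_lt_one_sub_exp_neg hα hε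
      have hlarge := RandomCSP.expUnlikely_large_core hess hsym hsat' r hα0.le
        (show 0 < RandomCSP.rhoK k α + ε by linarith)
        (fun y hy hy' => RandomCSP.one_sub_exp_neg_lt_of_rhoK_lt hα (by linarith) hy') hf
      have hsmall := RandomCSP.expUnlikely_small_core hess hsym hsat' r hα0 hy0 hy1 hy hf
      filter_upwards [(hlarge.or hsmall).eventually_le_plantedPr hsat' hg, eventually_ge_atTop k]
        with n hn hkn
      refine hn.trans (RandomCSP.plantedPr_mono hkn fun F σ hnot hedges => ?_)
      push Not at hnot
      have h1 := hnot.1 hedges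
      have h2 := hnot.2 hedges
      have h3 := mul_le_mul_of_nonneg_right hyε.le (Nat.cast_nonneg (α := ℝ) n)
      rw [abs_le]
      constructor <;> linarith
  · intro hα
    refine RandomCSP.exists_isLittleO_of_forall (fun n x => 1 - Real.exp (-g n) ≤
      Υ.plantedPr n ⌊r * n⌋₊ (fun F σ =>
        |((RandomCSP.Gam F σ).edges.card : ℝ) - α * n| ≤ f n →
          ((RandomCSP.Gam F σ).starCore.verts.card : ℝ) ≤ x)) ?_ ?_
    · filter_upwards [eventually_ge_atTop k] with n hn x x' hx h1
      exact h1.trans (RandomCSP.plantedPr_mono hn fun F σ h2 h3 => (h2 h3).trans hx)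
    · intro ε hε
      have hlarge : RandomCSP.ExpUnlikely Υ r fun n _ F σ =>
          |((RandomCSP.Gam F σ).edges.card : ℝ) - α * n| ≤ f n ∧
            ε * n < (RandomCSP.Gam F σ).starCore.verts.card := by
        rcases le_or_gt 0 α with hα0 | hα0
        · exact RandomCSP.expUnlikely_large_core hess hsym hsat' r hα0 hε
            (fun y hy hy' => RandomCSP.one_sub_exp_neg_lt_of_lt_alphaK hα (hε.trans_le hy) hy') hf
        · -- the number of hyperedges cannot be close to a negative number
          refine ⟨1, one_pos, 1, one_pos, ?_⟩
          filter_upwards [hf.bound (show 0 < -α / 2 by linarith), eventually_gt_atTop 0]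
            with n hfn hn0 σ _
          have hn : (0 : ℝ) < n := by exact_mod_cast hn0
          have hfn : f n ≤ -α / 2 * n := by
            have := (le_abs_self _).trans hfn
            rwa [Real.norm_eq_abs, abs_of_pos hn] at this
          have hno : ∀ F : RandomCSP.CSP k n ⌊r * n⌋₊,
              ¬ |((RandomCSP.Gam F σ).edges.card : ℝ) - α * n| ≤ f n := by
            intro F hF
            have h1 := (abs_le.1 hF).2
            have h2 : (0 : ℝ) ≤ (RandomCSP.Gam F σ).edges.card := Nat.cast_nonneg _
            nlinarith
          simp only [RandomCSP.CSPModel.condPr, hno, false_and, if_false, Finset.sum_const_zero]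
          positivity
      filter_upwards [hlarge.eventually_le_plantedPr hsat' hg, eventually_ge_atTop k]
        with n hn hkn
      refine hn.trans (RandomCSP.plantedPr_mono hkn fun F σ hnot hedges => ?_)
      push Not at hnot
      exact hnot hedges
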